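/- **Proposition.** Let $R$ be a commutative unital ring, $V$ a set, $F(V)$ the free loop on $V$, and $R[[V']]$ the algebra of formal power series over $R$ in the non-associative variables $x'$, $x\in V$; the power series with constant term $1$ form a loop under multiplication. The Magnus expansion $\mathcal M$ is the homomorphism from $F(V)$ to this loop with $\mathcal M(x)=1+x'$ for $x\in V$. In a loop (with left division $\backslash$) put $(a,b,c)=(a(bc))\backslash((ab)c)$, and for indices $1\le\alpha_k\le k+2$ $(k=1,\dots,l)$ define inductively the associator deviation of level $l$ by $$(a_1,\dots,a_{l+3})_{\alpha_1,\dots,\alpha_l}=\bigl(A(a_{\alpha_l})A(a_{\alpha_l+1})\bigr)\backslash A(a_{\alpha_l}a_{\alpha_l+1}),$$ where $A(t)=(a_1,\dots,a_{\alpha_l-1},t,a_{\alpha_l+2},\dots,a_{l+3})_{\alpha_1,\dots,\alpha_{l-1}}$. For $m,n\ge1$ let $$P_{m,n}(x_1,\dots,x_m,y_1,\dots,y_n,z)=(x_1,\dots,x_m,y_1,\dots,y_n,z)_{1,\dots,1,m+1,\dots,m+1},$$ with $m-1$ indices equal to $1$ followed by $n-1$ indices equal to $m+1$. In a unital non-associative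 algebra define the Shestakov–Umirbaev primitive operations $p_{r,s}(x_1,\dots,x_r;y_1,\dots,y_s;z)$, $r,s\ge1$, recursively by $$(uv)z-u(vz)=\sum u_{(1)}v_{(1)}\cdot p(u_{(2)};v_{(2)};z),\qquad u=(\cdots(x_1x_2)\cdots)x_r,\quad v=(\cdots(y_1y_2)\cdots)y_s,$$ where the sum is over all decompositions of the sequences $x_1,\dots,x_r$ and $y_1,\dots,y_s$ into complementary subsequences; $u_{(1)}$, $v_{(1)}$ are the left-normed products of the first subsequences (an empty product is $1$), $p(u_{(2)};v_{(2)};z)$ is the primitive operation applied to the second subsequences and to $z$, and it is $0$ if one of the second subsequences is empty. Then for all $m,n\ge 1$ and all (not necessarily distinct) generators $x_1,\dots,x_m,y_1,\dots,y_n,z\in V$, $$\mathcal M\bigl(P_{m,n}(x_1,\dots,x_m,y_1,\dots,y_n,z)\bigr)=1+p_{m,n}(x'_1,\dots,x'_m;y'_1,\dots,y'_n;z')+O(m+n+2),$$ where $O(m+n+2)$ is a power series without terms of degree less than $m+n+2$. Moreover, $p_{m,n}(x'_1,\dots,x'_m;y'_1,\dots,y'_n;z')$ is homogeneous of degree $m+n+1$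 and, if $R\neq0$, it is non-zero; so it is the leading term of the Magnus expansion of the deviation. -/

import Mathlib

namespace MagnusLoop

universe u v

/-! ### Loops -/

/-- A loop: a (non-associative) multiplication with a two-sided unit, in which left and right
multiplications are bijective; `ldiv a b` is `a \ b` and `rdiv b a` is `b / a`. -/
class Loop (L : Type u) extends MulOneClass L where
  /-- left division `a \ b` -/
  ldiv : L → L → L
  /-- right division `b / a` -/
  rdiv : L → L → L
  mul_ldiv : ∀ a b : L, a * ldiv a b = b
  ldiv_mul : ∀ a b : L, ldiv a (a * b) = b
  rdiv_mul : ∀ b a : L, rdiv b a * a = b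
  mul_rdiv : ∀ b a : L, rdiv (b * a) a = b

/-- The loop associator `(a, b, c) = (a(bc)) \ ((ab)c)`. -/
def loopAssociator {L : Type u} [Loop L] (a b c : L) : L :=
  Loop.ldiv (a * (b * c)) ((a * b) * c)

/-- The associator deviation of level `n`, a function `L ^ (n + 3) → L` indexed by a sequence
`α_1, …, α_n`, where the `k`-th index takes `k + 2` values. All indices start from `0` here:
`α i : Fin (i + 3)` stands for `α_{i+1} - 1`. For `k` the last index, and `A x` the deviation of
level `n` with the remaining indices, taken at the sequence `a` in which the two consecutive
entries at places `k` and `k + 1` are replaced by the single entry `x`, the value is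
`(A (a_k) A (a_{k+1})) \ A (a_k a_{k+1})`. -/
def deviation {L : Type u} [Loop L] :
    (n : ℕ) → (α : (i : Fin n) → Fin ((i : ℕ) + 3)) → (a : Fin (n + 3) → L) → L
  | 0, _, a => loopAssociator (a 0) (a 1) (a 2)
  | n + 1, α, a =>
      let k : Fin (n + 3) := α (Fin.last n)
      let A : L → L := fun x =>
        deviation n (fun i => α i.castSucc) (k.castSucc.contractNth (fun _ _ => x) a)
      Loop.ldiv (A (a k.castSucc) * A (a k.succ)) (A (a k.castSucc * a k.succ))

/-- `P_{m,n}(x_1, …, x_m, y_1, …, y_n, z)` for `m, n ≥ 1`: the deviation of level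
`(m - 1) + (n - 1)` of the sequence `x_1, …, x_m, y_1, …, y_n, z` with indices
`1, …, 1` (`m - 1` times) followed by `m + 1, …, m + 1` (`n - 1` times). -/
def deviationP {L : Type u} [Loop L] (m n : ℕ) (x : Fin m → L) (y : Fin n → L) (z : L) : L :=
  deviation ((m - 1) + (n - 1))
    (fun i => if h : (i : ℕ) < m - 1 then ⟨0, by omega⟩ else ⟨m, by omega⟩)
    (fun j => if h : (j : ℕ) < m then x ⟨j, h⟩
      else if h' : (j : ℕ) - m < n then y ⟨j - m, h'⟩ else z)

/-! ### The free loop -/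

/-- Words in the loop operations on the letters `V`. -/
inductive LoopWord (V : Type u) : Type u
  | of : V → LoopWord V
  | one : LoopWord V
  | mul : LoopWord V → LoopWord V → LoopWord V
  | ldiv : LoopWord V → LoopWord V → LoopWord V
  | rdiv : LoopWord V → LoopWord V → LoopWord V

/-- The congruence on words generated by the loop identities. -/
inductive LoopWord.Rel {V : Type u} : LoopWord V → LoopWord V → Prop
  | refl (a) : Rel a a
  | symm {a b} : Rel a b → Rel b a
  | trans {a b c} : Rel a b → Rel b c → Rel a c
  | mul {a b c d} : Rel a b → Rel c d → Rel (.mul a c) (.mul b d)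
  | ldiv {a b c d} : Rel a b → Rel c d → Rel (.ldiv a c) (.ldiv b d)
  | rdiv {a b c d} : Rel a b → Rel c d → Rel (.rdiv a c) (.rdiv b d)
  | one_mul (a) : Rel (.mul .one a) a
  | mul_one (a) : Rel (.mul a .one) a
  | mul_ldiv (a b) : Rel (.mul a (.ldiv a b)) b
  | ldiv_mul (a b) : Rel (.ldiv a (.mul a b)) b
  | rdiv_mul (b a) : Rel (.mul (.rdiv b a) a) b
  | mul_rdiv (b a) : Rel (.rdiv (.mul b a) a) b

/-- The congruence as a setoid. -/
def LoopWord.setoid (V : Type u) : Setoid (LoopWord V) :=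
  ⟨LoopWord.Rel, .refl, .symm, .trans⟩

/-- The free loop `F(V)`. -/
def FreeLoop (V : Type u) : Type u := Quotient (LoopWord.setoid V)

namespace FreeLoop

variable {V : Type u}

/-- The generators of the free loop. -/
def of (x : V) : FreeLoop V := Quotient.mk (LoopWord.setoid V) (.of x)

instance : One (FreeLoop V) := ⟨Quotient.mk (LoopWord.setoid V) .one⟩

instance : Mul (FreeLoop V) := ⟨Quotient.map₂ .mul fun _ _ h _ _ h' => .mul h h'⟩

instance : Loop (FreeLoop V) where
  ldiv := Quotient.map₂ .ldiv fun _ _ h _ _ h' => .ldiv h h'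
  rdiv := Quotient.map₂ .rdiv fun _ _ h _ _ h' => .rdiv h h'
  one_mul := by
    intro a
    obtain ⟨a, rfl⟩ := Quotient.exists_rep a
    exact Quotient.sound (.one_mul a)
  mul_one := by
    intro a
    obtain ⟨a, rfl⟩ := Quotient.exists_rep a
    exact Quotient.sound (.mul_one a)
  mul_ldiv a b := Quotient.inductionOn₂ a b fun a b => Quotient.sound (.mul_ldiv a b)
  ldiv_mul a b := Quotient.inductionOn₂ a b fun a b => Quotient.sound (.ldiv_mul a b)
  rdiv_mul b a := Quotient.inductionOn₂ b a fun b a => Quotient.sound (.rdiv_mul b a)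
  mul_rdiv b a := Quotient.inductionOn₂ b a fun b a => Quotient.sound (.mul_rdiv b a)

/-- Evaluation of words in a loop. -/
def evalWord {L : Type v} [Loop L] (f : V → L) : LoopWord V → L
  | .of x => f x
  | .one => 1
  | .mul a b => evalWord f a * evalWord f b
  | .ldiv a b => Loop.ldiv (evalWord f a) (evalWord f b)
  | .rdiv a b => Loop.rdiv (evalWord f a) (evalWord f b)

theorem evalWord_rel {L : Type v} [Loop L] (f : V → L) {a b : LoopWord V}
    (h : LoopWord.Rel a b) : evalWord f a = evalWord f b := by
  induction h with
  | refl => rfl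
  | symm _ ih => exact ih.symm
  | trans _ _ ih ih' => exact ih.trans ih'
  | mul _ _ ih ih' => simp only [evalWord, ih, ih']
  | ldiv _ _ ih ih' => simp only [evalWord, ih, ih']
  | rdiv _ _ ih ih' => simp only [evalWord, ih, ih']
  | one_mul a => exact one_mul _
  | mul_one a => exact mul_one _
  | mul_ldiv a b => exact Loop.mul_ldiv _ _
  | ldiv_mul a b => exact Loop.ldiv_mul _ _
  | rdiv_mul a b => exact Loop.rdiv_mul _ _
  | mul_rdiv a b => exact Loop.mul_rdiv _ _

/-- The homomorphism from the free loop to a loop `L` that extends a map of the generators. -/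
def lift {L : Type v} [Loop L] (f : V → L) : FreeLoop V →* L where
  toFun := Quotient.lift (evalWord f) fun _ _ h => evalWord_rel f h
  map_one' := rfl
  map_mul' := by rintro ⟨a⟩ ⟨b⟩; rfl

theorem lift_of {L : Type v} [Loop L] (f : V → L) (x : V) : lift f (of x) = f x := rfl

/-- A homomorphism from the free loop is determined by its values on the generators. -/
theorem eq_lift {L : Type v} [Loop L] (f : V → L) (g : FreeLoop V →* L)
    (h : ∀ x, g (of x) = f x) : g = lift f := by
  have hl : ∀ a b, g (Loop.ldiv a b) = Loop.ldiv (g a) (g b) := fun a b => by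
    conv_rhs => rw [← Loop.mul_ldiv a b, map_mul, Loop.ldiv_mul]
  have hr : ∀ a b, g (Loop.rdiv a b) = Loop.rdiv (g a) (g b) := fun a b => by
    conv_rhs => rw [← Loop.rdiv_mul a b, map_mul, Loop.mul_rdiv]
  ext w
  obtain ⟨w, rfl⟩ := Quotient.exists_rep w
  let mk : LoopWord V → FreeLoop V := Quotient.mk (LoopWord.setoid V)
  induction w with
  | of x => exact h x
  | one => exact map_one g
  | mul a b iha ihb =>
    exact (map_mul g (mk a) (mk b)).trans (congrArg₂ (· * ·) iha ihb)
  | ldiv a b iha ihb =>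
    exact (hl (mk a) (mk b)).trans (congrArg₂ Loop.ldiv iha ihb)
  | rdiv a b iha ihb =>
    exact (hr (mk a) (mk b)).trans (congrArg₂ Loop.rdiv iha ihb)

end FreeLoop

/-! ### Non-associative power series -/

/-- Monomials in the non-associative variables `V`: bracketed words, and the empty monomial `1`. -/
abbrev Monomial (V : Type u) : Type u := WithOne (FreeMagma V)

/-- The degree of a monomial. -/
def Monomial.degree {V : Type u} (w : Monomial V) : ℕ := WithOne.recOneCoe 0 FreeMagma.length w

/-- The list of all factorizations of a bracketed word into two monomials. -/
def wordFactorizations {V : Type u} : FreeMagma V → List (Monomial V × Monomial V)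
  | .of v => [(1, (FreeMagma.of v : Monomial V)), ((FreeMagma.of v : Monomial V), 1)]
  | .mul s t => [(1, ((s * t : FreeMagma V) : Monomial V)), (((s * t : FreeMagma V) : Monomial V), 1),
      ((s : Monomial V), (t : Monomial V))]

/-- The list of all pairs of monomials with product `w`. -/
def factorizations {V : Type u} (w : Monomial V) : List (Monomial V × Monomial V) :=
  WithOne.recOneCoe [(1, 1)] wordFactorizations w

theorem mem_factorizations {V : Type u} (w : Monomial V) (p : Monomial V × Monomial V) :
    p ∈ factorizations w ↔ p.1 * p.2 = w := by
  have h1 : ∀ s : FreeMagma V, (s : Monomial V) ≠ 1 := fun s => WithOne.coe_ne_one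
  have h2 : ∀ s : FreeMagma V, (1 : Monomial V) ≠ s := fun s => WithOne.one_ne_coe
  obtain ⟨a, b⟩ := p
  cases w using WithOne.recOneCoe with
  | one =>
    cases a using WithOne.recOneCoe <;> cases b using WithOne.recOneCoe <;>
      simp [factorizations, ← WithOne.coe_mul, h1]
  | coe w =>
    cases w <;> cases a using WithOne.recOneCoe <;> cases b using WithOne.recOneCoe <;>
      simp [factorizations, wordFactorizations, ← WithOne.coe_mul, h1, h2]
    constructor
    · rintro ⟨rfl, rfl⟩
      rfl
    · intro h
      injection h with h h'
      exact ⟨h, h'⟩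

theorem nodup_factorizations {V : Type u} (w : Monomial V) : (factorizations w).Nodup := by
  cases w using WithOne.recOneCoe with
  | one => simp [factorizations]
  | coe w =>
    cases w with
    | of v => simp [factorizations, wordFactorizations]
    | mul s t =>
      have h : ((s * t : FreeMagma V) : Monomial V) ≠ 1 := WithOne.coe_ne_one
      change List.Nodup [(1, ((s * t : FreeMagma V) : Monomial V)),
        (((s * t : FreeMagma V) : Monomial V), 1), _]
      generalize ((s * t : FreeMagma V) : Monomial V) = w at h
      simp [h.symm]

/-- Formal power series over `R` in the non-associative variables `V`: arbitrary families of
coefficients indexed by the monomials. -/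
def NAPowerSeries (V : Type u) (R : Type v) : Type (max u v) := Monomial V → R

namespace NAPowerSeries

variable {V : Type u} {R : Type v}

/-- The coefficient of a monomial. -/
def coeff (w : Monomial V) (f : NAPowerSeries V R) : R := f w

@[ext] theorem ext {f g : NAPowerSeries V R} (h : ∀ w, coeff w f = coeff w g) : f = g := funext h

/-- Two series are equal if they agree at `1`, at the letters and at the products. -/
theorem ext_cases {f g : NAPowerSeries V R} (h1 : coeff 1 f = coeff 1 g)
    (hof : ∀ v : V, coeff (FreeMagma.of v : Monomial V) f = coeff (FreeMagma.of v : Monomial V) g)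
    (hmul : ∀ s t : FreeMagma V, coeff ((s * t : FreeMagma V) : Monomial V) f =
      coeff ((s * t : FreeMagma V) : Monomial V) g) : f = g := by
  ext w
  cases w using WithOne.recOneCoe with
  | one => exact h1
  | coe w =>
    exact FreeMagma.casesOn (motive := fun w : FreeMagma V => coeff (w : Monomial V) f = coeff (w : Monomial V) g)
      w hof hmul

variable [CommRing R]

instance : AddCommGroup (NAPowerSeries V R) := inferInstanceAs (AddCommGroup (Monomial V → R))

/-- The product of power series: `(f g)_w = ∑ f_a g_b` over the factorizations `w = a b`. -/
instance : Mul (NAPowerSeries V R) :=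
  ⟨fun f g w => ((factorizations w).map fun p => coeff p.1 f * coeff p.2 g).sum⟩

open Classical in
/-- The power series with a single term, a monomial with coefficient `1`. -/
noncomputable def ofMonomial (R : Type v) [CommRing R] (w : Monomial V) : NAPowerSeries V R :=
  fun w' => if w' = w then 1 else 0

noncomputable instance : One (NAPowerSeries V R) := ⟨ofMonomial R 1⟩

/-- The variable `x'` that corresponds to the letter `x`. -/
noncomputable def X (R : Type v) [CommRing R] (x : V) : NAPowerSeries V R :=
  ofMonomial R (FreeMagma.of x : Monomial V)

theorem coeff_mul (w : Monomial V) (f g : NAPowerSeries V R) :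
    coeff w (f * g) = ((factorizations w).map fun p => coeff p.1 f * coeff p.2 g).sum := rfl

theorem coeff_one_mul (f g : NAPowerSeries V R) :
    coeff 1 (f * g) = coeff 1 f * coeff 1 g := by
  simp [coeff_mul, factorizations]

theorem coeff_of_mul (v : V) (f g : NAPowerSeries V R) :
    coeff (FreeMagma.of v : Monomial V) (f * g) =
      coeff 1 f * coeff (FreeMagma.of v : Monomial V) g +
        coeff (FreeMagma.of v : Monomial V) f * coeff 1 g := by
  simp [coeff_mul, factorizations, wordFactorizations]

theorem coeff_mul_mul (s t : FreeMagma V) (f g : NAPowerSeries V R) :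
    coeff ((s * t : FreeMagma V) : Monomial V) (f * g) =
      coeff 1 f * coeff ((s * t : FreeMagma V) : Monomial V) g +
        (coeff ((s * t : FreeMagma V) : Monomial V) f * coeff 1 g +
          coeff (s : Monomial V) f * coeff (t : Monomial V) g) := by
  rw [coeff_mul]
  change List.sum [_, _, _] = _
  simp only [List.sum_cons, List.sum_nil, add_zero]

@[simp] theorem coeff_zero (w : Monomial V) : coeff w (0 : NAPowerSeries V R) = 0 := rfl

@[simp] theorem coeff_add (w : Monomial V) (f g : NAPowerSeries V R) :
    coeff w (f + g) = coeff w f + coeff w g := rfl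

@[simp] theorem coeff_one_one : coeff 1 (1 : NAPowerSeries V R) = 1 := if_pos rfl

@[simp] theorem coeff_coe_one (s : FreeMagma V) :
    coeff (s : Monomial V) (1 : NAPowerSeries V R) = 0 := if_neg WithOne.coe_ne_one

noncomputable instance : NonAssocRing (NAPowerSeries V R) where
  left_distrib f g h := by
    apply ext_cases <;> intros <;>
      simp only [coeff_add, coeff_one_mul, coeff_of_mul, coeff_mul_mul] <;> ring
  right_distrib f g h := by
    apply ext_cases <;> intros <;>
      simp only [coeff_add, coeff_one_mul, coeff_of_mul, coeff_mul_mul] <;> ring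
  zero_mul f := by
    apply ext_cases <;> intros <;>
      simp only [coeff_one_mul, coeff_of_mul, coeff_mul_mul, coeff_zero] <;> ring
  mul_zero f := by
    apply ext_cases <;> intros <;>
      simp only [coeff_one_mul, coeff_of_mul, coeff_mul_mul, coeff_zero] <;> ring
  one_mul f := by
    apply ext_cases <;> intros <;>
      simp only [coeff_one_mul, coeff_of_mul, coeff_mul_mul, coeff_one_one, coeff_coe_one] <;> ring
  mul_one f := by
    apply ext_cases <;> intros <;>
      simp only [coeff_one_mul, coeff_of_mul, coeff_mul_mul, coeff_one_one, coeff_coe_one] <;> ring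

/-- Coefficients, in positive degree, of the solution `c` of `a c = b` with constant term `1`,
for `a` and `b` with constant term `1`. -/
def ldivCoeff (a b : NAPowerSeries V R) : FreeMagma V → R
  | .of v => coeff (FreeMagma.of v : Monomial V) b - coeff (FreeMagma.of v : Monomial V) a
  | .mul s t => coeff ((s * t : FreeMagma V) : Monomial V) b -
      coeff ((s * t : FreeMagma V) : Monomial V) a - coeff (s : Monomial V) a * ldivCoeff a b t

/-- Coefficients, in positive degree, of the solution `c` of `c a = b` with constant term `1`,
for `a` and `b` with constant term `1`. -/
def rdivCoeff (b a : NAPowerSeries V R) : FreeMagma V → R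
  | .of v => coeff (FreeMagma.of v : Monomial V) b - coeff (FreeMagma.of v : Monomial V) a
  | .mul s t => coeff ((s * t : FreeMagma V) : Monomial V) b -
      coeff ((s * t : FreeMagma V) : Monomial V) a - rdivCoeff b a s * coeff (t : Monomial V) a

/-- The power series with constant term `1` and given coefficients in positive degree. -/
def ofCoeff (c : FreeMagma V → R) : NAPowerSeries V R := fun w => WithOne.recOneCoe 1 c w

@[simp] theorem coeff_one_ofCoeff (c : FreeMagma V → R) : coeff 1 (ofCoeff c) = 1 := rfl

@[simp] theorem coeff_coe_ofCoeff (c : FreeMagma V → R) (s : FreeMagma V) :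
    coeff (s : Monomial V) (ofCoeff c) = c s := rfl

end NAPowerSeries

/-- `R_0[[V]]`: the power series with constant term `1`. -/
def UnitSeries (V : Type u) (R : Type v) [CommRing R] : Type (max u v) :=
  {f : NAPowerSeries V R // NAPowerSeries.coeff 1 f = 1}

namespace UnitSeries

open NAPowerSeries

variable {V : Type u} {R : Type v} [CommRing R]

noncomputable instance : One (UnitSeries V R) := ⟨⟨1, coeff_one_one⟩⟩

instance : Mul (UnitSeries V R) :=
  ⟨fun f g => ⟨f.1 * g.1, by rw [coeff_one_mul, f.2, g.2, one_mul]⟩⟩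

theorem val_mul (f g : UnitSeries V R) : (f * g).1 = f.1 * g.1 := rfl

theorem val_one : (1 : UnitSeries V R).1 = 1 := rfl

/-- `R_0[[V]]` is a loop under multiplication of power series. -/
noncomputable instance : Loop (UnitSeries V R) where
  one_mul f := Subtype.ext (one_mul f.1)
  mul_one f := Subtype.ext (mul_one f.1)
  ldiv a b := ⟨ofCoeff (ldivCoeff a.1 b.1), rfl⟩
  rdiv b a := ⟨ofCoeff (rdivCoeff b.1 a.1), rfl⟩
  mul_ldiv a b := by
    refine Subtype.ext (show a.1 * ofCoeff (ldivCoeff a.1 b.1) = b.1 from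
      ext_cases ?_ (fun v => ?_) (fun s t => ?_)) <;>
      simp only [coeff_one_mul, coeff_of_mul, coeff_mul_mul, a.2, b.2, coeff_one_ofCoeff,
        coeff_coe_ofCoeff, ldivCoeff] <;> ring
  ldiv_mul a b := by
    refine Subtype.ext (ext fun w => ?_)
    cases w using WithOne.recOneCoe with
    | one => exact b.2.symm
    | coe w =>
      rw [coeff_coe_ofCoeff]
      induction w using FreeMagma.rec with
      | of v => simp only [ldivCoeff, val_mul, coeff_of_mul, a.2, b.2]; ring
      | mul s t _ ih =>
        rw [ldivCoeff, ih]
        simp only [val_mul, coeff_mul_mul, a.2, b.2]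
        change _ = coeff ((s * t : FreeMagma V) : Monomial V) b.1
        ring
  rdiv_mul b a := by
    refine Subtype.ext (show ofCoeff (rdivCoeff b.1 a.1) * a.1 = b.1 from
      ext_cases ?_ (fun v => ?_) (fun s t => ?_)) <;>
      simp only [coeff_one_mul, coeff_of_mul, coeff_mul_mul, a.2, b.2, coeff_one_ofCoeff,
        coeff_coe_ofCoeff, rdivCoeff] <;> ring
  mul_rdiv b a := by
    refine Subtype.ext (ext fun w => ?_)
    cases w using WithOne.recOneCoe with
    | one => exact b.2.symm
    | coe w =>
      rw [coeff_coe_ofCoeff]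
      induction w using FreeMagma.rec with
      | of v => simp only [rdivCoeff, val_mul, coeff_of_mul, a.2, b.2]; ring
      | mul s t ih _ =>
        rw [rdivCoeff, ih]
        simp only [val_mul, coeff_mul_mul, a.2, b.2]
        change _ = coeff ((s * t : FreeMagma V) : Monomial V) b.1
        ring

end UnitSeries

/-- The Magnus expansion as a homomorphism of loops `F(V) → R_0[[V']]` with `x ↦ 1 + x'`. -/
noncomputable def magnusHom (V : Type u) (R : Type v) [CommRing R] :
    FreeLoop V →* UnitSeries V R :=
  FreeLoop.lift fun x => ⟨1 + NAPowerSeries.X R x, by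
    rw [NAPowerSeries.coeff_add, NAPowerSeries.coeff_one_one]
    exact add_eq_left.mpr (if_neg WithOne.one_ne_coe)⟩

/-- The Magnus expansion of an element of the free loop, as a power series. -/
noncomputable def magnus {V : Type u} (R : Type v) [CommRing R] (w : FreeLoop V) :
    NAPowerSeries V R :=
  (magnusHom V R w).1

/-! ### The primitive operations of Shestakov and Umirbaev -/

section PrimitiveOperations

variable {A : Type u} [NonAssocRing A]

/-- The left-normed product `(…(x_1 x_2)…) x_r`, equal to `1` for the empty sequence. -/
def leftProd {r : ℕ} (x : Fin r → A) : A := (List.ofFn x).foldl (· * ·) 1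

/-- The subsequence of `x` with places in `I`. -/
def subseq {r : ℕ} (x : Fin r → A) (I : Finset (Fin r)) : Fin I.card → A :=
  fun i => x (I.orderEmbOfFin rfl i)

/-- The primitive operations `p_{r,s}(x_1, …, x_r; y_1, …, y_s; z)`, defined recursively by
`(uv)z - u(vz) = ∑ u₁v₁ · p(u₂; v₂; z)` with `u = (…(x_1 x_2)…) x_r`, `v = (…(y_1 y_2)…) y_s`, where
the sum is over all decompositions of the two sequences into complementary subsequences; the
places of `u₂` and `v₂` are `I` and `J` here. The term with `u₂ = u`, `v₂ = v` is
`p_{r,s}(x; y; z)` itself, the other ones involve fewer arguments. Terms with `u₂` or `v₂`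
empty vanish. -/
def primOp (r s : ℕ) (x : Fin r → A) (y : Fin s → A) (z : A) : A :=
  (leftProd x * leftProd y) * z - leftProd x * (leftProd y * z) -
    ∑ I : Finset (Fin r), ∑ J : Finset (Fin s),
      if _h : I.card + J.card < r + s then
        (leftProd (subseq x Iᶜ) * leftProd (subseq y Jᶜ)) *
          primOp I.card J.card (subseq x I) (subseq y J) z
      else 0
termination_by r + s

theorem primOp_eq_zero (r s : ℕ) (x : Fin r → A) (y : Fin s → A) (z : A) (h : r = 0 ∨ s = 0) :
    primOp r s x y z = 0 := by
  induction hn : r + s using Nat.strong_induction_on generalizing r s with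
  | _ n ih =>
    rw [primOp, Finset.sum_eq_zero, sub_zero]
    · rcases h with rfl | rfl <;> simp [leftProd]
    · intro I _
      refine Finset.sum_eq_zero fun J _ => ?_
      split_ifs with hlt
      · rw [ih (I.card + J.card) (by omega) I.card J.card _ _ ?_ rfl, mul_zero]
        have hI := Finset.card_le_univ I
        have hJ := Finset.card_le_univ J
        rw [Fintype.card_fin] at hI hJ
        omega
      · rfl

theorem primOp_comp {r s k l : ℕ} (x : Fin r → A) (y : Fin s → A) (z : A)
    (e : Fin k ↪o Fin r) (f : Fin l ↪o Fin s) (hk : k = r) (hl : l = s) :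
    primOp k l (fun i => x (e i)) (fun j => y (f j)) z = primOp r s x y z := by
  subst hk hl
  have he : e = RelEmbedding.refl _ :=
    (Finset.orderEmbOfFin_unique' (Finset.card_fin _) fun _ => Finset.mem_univ _).trans
      (Finset.orderEmbOfFin_unique' (Finset.card_fin _) fun _ => Finset.mem_univ _).symm
  have hf : f = RelEmbedding.refl _ :=
    (Finset.orderEmbOfFin_unique' (Finset.card_fin _) fun _ => Finset.mem_univ _).trans
      (Finset.orderEmbOfFin_unique' (Finset.card_fin _) fun _ => Finset.mem_univ _).symm
  subst he hf
  rfl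

/-- The defining identity of the primitive operations. -/
theorem primOp_identity (r s : ℕ) (x : Fin r → A) (y : Fin s → A) (z : A) :
    (leftProd x * leftProd y) * z - leftProd x * (leftProd y * z) =
      ∑ I : Finset (Fin r), ∑ J : Finset (Fin s),
        (leftProd (subseq x Iᶜ) * leftProd (subseq y Jᶜ)) *
          primOp I.card J.card (subseq x I) (subseq y J) z := by
  have hlp : ∀ (k : ℕ) (w : Fin k → A), k = 0 → leftProd w = 1 := by
    rintro k w rfl
    simp [leftProd]
  have key : ∀ (I : Finset (Fin r)) (J : Finset (Fin s)),
      (leftProd (subseq x Iᶜ) * leftProd (subseq y Jᶜ)) *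
          primOp I.card J.card (subseq x I) (subseq y J) z =
        (if _h : I.card + J.card < r + s then
          (leftProd (subseq x Iᶜ) * leftProd (subseq y Jᶜ)) *
            primOp I.card J.card (subseq x I) (subseq y J) z
        else 0) + if I = Finset.univ then (if J = Finset.univ then primOp r s x y z else 0)
          else 0 := by
    intro I J
    have hI := Finset.card_le_univ I
    have hJ := Finset.card_le_univ J
    have hI' := Finset.card_eq_iff_eq_univ I
    have hJ' := Finset.card_eq_iff_eq_univ J
    rw [Fintype.card_fin] at hI hJ hI' hJ'
    by_cases h : I = Finset.univ ∧ J = Finset.univ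
    · have hIc := hI'.mpr h.1
      have hJc := hJ'.mpr h.2
      rw [dif_neg (by omega), if_pos h.1, if_pos h.2, zero_add,
        hlp _ (subseq x Iᶜ) (by simp [h.1]), hlp _ (subseq y Jᶜ) (by simp [h.2]), one_mul,
        one_mul]
      exact primOp_comp x y z (I.orderEmbOfFin rfl) (J.orderEmbOfFin rfl) hIc hJc
    · have hlt : I.card + J.card < r + s := by
        by_contra hge
        exact h ⟨hI'.mp (by omega), hJ'.mp (by omega)⟩
      rw [dif_pos hlt]
      by_cases h1 : I = Finset.univ
      · rw [if_pos h1, if_neg (fun h2 => h ⟨h1, h2⟩), add_zero]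
      · rw [if_neg h1, add_zero]
  rw [Finset.sum_congr rfl fun I _ => Finset.sum_congr rfl fun J _ => key I J]
  simp only [Finset.sum_add_distrib, Finset.sum_ite_irrel, Finset.sum_ite_eq', Finset.mem_univ, if_true,
    Finset.sum_const_zero]
  rw [primOp]
  abel

end PrimitiveOperations

end MagnusLoop

open MagnusLoop

/-!
Substituting letters commutes with `𝓜`, `P_{m,n}` and `p_{m,n}` and preserves degrees, so the
letters `x_1, …, x_m, y_1, …, y_n, z` may be taken to be distinct. Sending any one of them to `1`
trivializes `P_{m,n}`; hence every monomial of `𝓜(P_{m,n}) - 1` contains all of them, and up to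
degree `m + n + 1` it suffices to compute modulo the ideal of monomials with a repeated letter.
There, products of series that involve a common letter vanish, so:

* the defining identity of the primitive operations, summed over all pairs of subsequences, says
  that the associator of the products of `1 + x_i'`, `i ∈ I`, and of `1 + y_j'`, `j ∈ J`, with
  `1 + z'` is `1 + ∑ p(S; T; z)`, where the sum is over `S ⊆ I` and `T ⊆ J`;
* `(1 + f)(1 + g) \ (1 + h) = 1 + (h - f - g)` when `f`, `g`, `h` involve `z`, so that each
  deviation step keeps from a sum over subsets the terms whose subset contains the new letter, and
  only `p_{m,n}` itself survives.
-/

namespace MagnusLoop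

universe u v w

section PowersetSums

open Finset

variable {ι : Type u} [DecidableEq ι]

theorem sum_powerset_sdiff {M : Type v} [AddCommMonoid M] (f : Finset ι → Finset ι → M)
    (hf : ∀ S T, ¬ Disjoint S T → f S T = 0) (I : Finset ι) :
    ∑ K ∈ I.powerset, ∑ T ∈ K.powerset, f (K \ T) T =
      ∑ S ∈ I.powerset, ∑ T ∈ I.powerset, f S T := by
  rw [sum_comm' (t' := I.powerset) (s' := fun T => Icc T I), sum_comm]
  · refine sum_congr rfl fun T hT => sum_of_injOn (· \ T) ?_ ?_ ?_ fun _ _ => rfl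
    · intro K hK K' hK' h
      rw [← sdiff_union_of_subset (mem_Icc.mp hK).1, ← sdiff_union_of_subset (mem_Icc.mp hK').1]
      exact congrArg (· ∪ T) h
    · exact fun K hK => mem_powerset.mpr (sdiff_subset.trans (mem_Icc.mp hK).2)
    · refine fun S hS hST => hf S T fun hdis =>
        hST ⟨S ∪ T, mem_Icc.mpr ⟨subset_union_right, ?_⟩, ?_⟩
      · exact union_subset (mem_powerset.mp hS) (mem_powerset.mp hT)
      · exact union_sdiff_cancel_right hdis
  · simp only [mem_powerset, mem_Icc]
    exact fun K T => ⟨fun h => ⟨⟨h.2, h.1⟩, h.2.trans h.1⟩, fun h => ⟨h.1.2, h.1.1⟩⟩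

theorem sum_powerset_insert_erase_empty {M : Type v} [AddCommGroup M] (F : Finset ι → M)
    {a : ι} {I : Finset ι} (ha : a ∉ I) :
    ∑ S ∈ (insert a I).powerset.erase ∅, F S - ∑ S ∈ I.powerset.erase ∅, F S - F {a} =
      ∑ S ∈ I.powerset.erase ∅, F (insert a S) := by
  simp only [sum_erase_eq_sub, empty_mem_powerset, sum_powerset_insert ha, insert_empty_eq]
  abel

end PowersetSums

section SubsetOperations

variable {A : Type u} [NonAssocRing A] {r s : ℕ}

theorem ofFn_subseq {X : Type v} (x : Fin r → X) (I : Finset (Fin r)) :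
    List.ofFn (subseq x I) = I.sort.map x := by
  rw [← Finset.listMap_orderEmbOfFin_finRange I rfl, List.map_map, List.ofFn_eq_map]
  rfl

theorem sort_insert_of_forall_lt {ι : Type u} [LinearOrder ι] {a : ι} {I : Finset ι}
    (ha : ∀ i ∈ I, i < a) : (insert a I).sort = I.sort ++ [a] := by
  refine (Finset.sortedLT_sort _).eq_of_mem_iff (List.Pairwise.sortedLT ?_) fun i => by
    simp only [Finset.mem_sort, Finset.mem_insert, List.mem_append, List.mem_singleton, or_comm]
  exact List.pairwise_append.mpr ⟨I.sortedLT_sort.pairwise, List.pairwise_singleton _ _,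
    fun i hi b hb => List.mem_singleton.mp hb ▸ ha i ((Finset.mem_sort _).mp hi)⟩

/-- The left-normed product of the entries of `x` with places in `I`. -/
def leftProdOn (x : Fin r → A) (I : Finset (Fin r)) : A := leftProd (subseq x I)

/-- The primitive operation applied to the entries of `x` with places in `I`, those of `y` with
places in `J`, and `z`. -/
def primOpOn (x : Fin r → A) (y : Fin s → A) (z : A) (I : Finset (Fin r)) (J : Finset (Fin s)) :
    A :=
  primOp I.card J.card (subseq x I) (subseq y J) z

theorem leftProd_congr {x : Fin r → A} {x' : Fin s → A} (h : List.ofFn x = List.ofFn x') :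
    leftProd x = leftProd x' := by rw [leftProd, leftProd, h]

theorem primOp_congr {r' s' : ℕ} {x : Fin r → A} {x' : Fin r' → A} {y : Fin s → A}
    {y' : Fin s' → A} (hx : List.ofFn x = List.ofFn x') (hy : List.ofFn y = List.ofFn y')
    (z : A) : primOp r s x y z = primOp r' s' x' y' z := by
  cases List.ofFn_inj'.mp hx
  cases List.ofFn_inj'.mp hy
  rfl

theorem leftProdOn_empty (x : Fin r → A) : leftProdOn x ∅ = 1 := rfl

theorem leftProdOn_insert (x : Fin r → A) {a : Fin r} {I : Finset (Fin r)}
    (ha : ∀ i ∈ I, i < a) : leftProdOn x (insert a I) = leftProdOn x I * x a := by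
  simp only [leftProdOn, leftProd, ofFn_subseq, sort_insert_of_forall_lt ha, List.map_append,
    List.map_singleton, List.foldl_append, List.foldl_cons, List.foldl_nil]

theorem leftProdOn_singleton (x : Fin r → A) (a : Fin r) : leftProdOn x {a} = x a := by
  rw [← insert_empty_eq, leftProdOn_insert x (by simp), leftProdOn_empty, one_mul]

theorem leftProdOn_one_add (x : Fin r → A) (I : Finset (Fin r)) :
    leftProdOn (fun i => 1 + x i) I = ∑ S ∈ I.powerset, leftProdOn x S := by
  induction I using Finset.induction_on_max with
  | empty => rw [Finset.powerset_empty, Finset.sum_singleton, leftProdOn_empty, leftProdOn_empty]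
  | insert a I ha ih =>
    have hmax : ∀ S ∈ I.powerset, leftProdOn x (insert a S) = leftProdOn x S * x a :=
      fun S hS => leftProdOn_insert x fun i hi => ha i (Finset.mem_powerset.mp hS hi)
    rw [leftProdOn_insert _ ha, ih, mul_add, mul_one,
      Finset.sum_powerset_insert fun h => (ha a h).false, Finset.sum_mul,
      Finset.sum_congr rfl hmax]

theorem primOpOn_univ (x : Fin r → A) (y : Fin s → A) (z : A) :
    primOpOn x y z Finset.univ Finset.univ = primOp r s x y z :=
  primOp_comp x y z _ _ (Finset.card_fin r) (Finset.card_fin s)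

theorem primOpOn_empty_left (x : Fin r → A) (y : Fin s → A) (z : A) (J : Finset (Fin s)) :
    primOpOn x y z ∅ J = 0 :=
  primOp_eq_zero _ _ _ _ _ (Or.inl Finset.card_empty)

theorem primOpOn_empty_right (x : Fin r → A) (y : Fin s → A) (z : A) (I : Finset (Fin r)) :
    primOpOn x y z I ∅ = 0 :=
  primOp_eq_zero _ _ _ _ _ (Or.inr Finset.card_empty)

theorem ofFn_subseq_subseq {X : Type v} (x : Fin r → X) (I : Finset (Fin r))
    (S : Finset (Fin I.card)) :
    List.ofFn (subseq (subseq x I) S) =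
      List.ofFn (subseq x (S.map (I.orderEmbOfFin rfl).toEmbedding)) := by
  rw [ofFn_subseq, ofFn_subseq, ← StrictMonoOn.map_finsetSort (I.orderEmbOfFin rfl).toEmbedding S
    ((I.orderEmbOfFin rfl).strictMono.strictMonoOn _), List.map_map]
  rfl

theorem sum_map_orderEmbOfFin {ι : Type v} [LinearOrder ι] {M : Type w} [AddCommMonoid M]
    (I : Finset ι) (G : Finset ι → M) :
    ∑ S : Finset (Fin I.card), G (S.map (I.orderEmbOfFin rfl).toEmbedding) =
      ∑ S ∈ I.powerset, G S := by
  refine Finset.sum_of_injOn (Finset.map (I.orderEmbOfFin rfl).toEmbedding)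
    (Finset.map_injective _).injOn ?_ ?_ fun _ _ => rfl
  · intro S _
    rw [Finset.mem_coe, Finset.mem_powerset]
    exact (Finset.map_subset_map.mpr S.subset_univ).trans_eq (Finset.map_orderEmbOfFin_univ I rfl)
  · intro S hS hS'
    rw [← Finset.map_orderEmbOfFin_univ I rfl, Finset.mem_powerset, Finset.subset_map_iff] at hS
    obtain ⟨T, -, rfl⟩ := hS
    exact absurd ⟨T, Finset.mem_coe.mpr (Finset.mem_univ T), rfl⟩ hS'

theorem sum_orderEmbOfFin {ι : Type u} [LinearOrder ι] {M : Type v} [AddCommMonoid M]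
    (I : Finset ι) (μ : ι → M) : ∑ i, μ (I.orderEmbOfFin rfl i) = ∑ i ∈ I, μ i := by
  conv_rhs => rw [← Finset.map_orderEmbOfFin_univ I rfl, Finset.sum_map]
  rfl

theorem primOpOn_identity (x : Fin r → A) (y : Fin s → A) (z : A) (I : Finset (Fin r))
    (J : Finset (Fin s)) :
    (leftProdOn x I * leftProdOn y J) * z - leftProdOn x I * (leftProdOn y J * z) =
      ∑ S ∈ I.powerset, ∑ T ∈ J.powerset,
        (leftProdOn x (I \ S) * leftProdOn y (J \ T)) * primOpOn x y z S T := by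
  have map_compl {k : ℕ} (K : Finset (Fin k)) (S : Finset (Fin K.card)) :
      Sᶜ.map (K.orderEmbOfFin rfl).toEmbedding = K \ S.map (K.orderEmbOfFin rfl).toEmbedding := by
    rw [Finset.compl_eq_univ_sdiff, Finset.map_sdiff, Finset.map_orderEmbOfFin_univ]
  rw [leftProdOn, leftProdOn, primOp_identity, ← sum_map_orderEmbOfFin I]
  refine Finset.sum_congr rfl fun S _ => ?_
  rw [← sum_map_orderEmbOfFin J]
  refine Finset.sum_congr rfl fun T _ => ?_
  rw [leftProd_congr (ofFn_subseq_subseq x I _), leftProd_congr (ofFn_subseq_subseq y J _),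
    primOp_congr (ofFn_subseq_subseq x I S) (ofFn_subseq_subseq y J T), map_compl, map_compl]
  rfl

end SubsetOperations

section Deviations

variable {L : Type u} [Loop L]

theorem ldiv_self (a : L) : Loop.ldiv a a = 1 := by
  simpa only [mul_one] using Loop.ldiv_mul a 1

/-- The deviation of a function of one variable from being multiplicative, iterated: `A t` for the
empty list, and `(D t · D s) \ D (t s)` for a list `s :: l`, where `D` is the deviation for `l`. -/
def iterDeviation {G : Type v} [Mul G] (A : G → L) : G → List G → L
  | t, [] => A t
  | t, s :: l => Loop.ldiv (iterDeviation A t l * iterDeviation A s l) (iterDeviation A (t * s) l)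

theorem iterDeviation_eq_one_of_forall {G : Type v} [Mul G] {A : G → L} (hA : ∀ t, A t = 1) (t : G)
    (l : List G) : iterDeviation A t l = 1 := by
  induction l generalizing t with
  | nil => exact hA t
  | cons s l ih => rw [iterDeviation, ih, ih, ih, one_mul, ldiv_self]

theorem iterDeviation_eq_one {G : Type v} [MulOneClass G] {A : G → L} (hA : A 1 = 1) (t : G)
    (l : List G) (h : t = 1 ∨ 1 ∈ l) : iterDeviation A t l = 1 := by
  induction l generalizing t with
  | nil => rw [h.resolve_right List.not_mem_nil, iterDeviation, hA]
  | cons s l ih =>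
    have hone : iterDeviation A 1 l = 1 := ih 1 (Or.inl rfl)
    rw [List.mem_cons] at h
    rcases h with rfl | rfl | h
    · rw [iterDeviation, hone, one_mul, one_mul, ldiv_self]
    · rw [iterDeviation, hone, mul_one, mul_one, ldiv_self]
    · rw [iterDeviation, ih _ (Or.inr h), ih _ (Or.inr h), ih _ (Or.inr h), one_mul, ldiv_self]

/-- The first `N` terms of the sequence `x_1, …, x_m, y_1, …, y_n, z, z, …`, the shape in which
`deviationP` receives its arguments. -/
def argSeq {X : Type v} {m n : ℕ} (N : ℕ) (x : Fin m → X) (y : Fin n → X) (z : X) : Fin N → X :=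
  fun j => if h : (j : ℕ) < m then x ⟨j, h⟩
    else if h' : (j : ℕ) - m < n then y ⟨j - m, h'⟩ else z

theorem contractNth_argSeq_left {X : Type v} {m n N : ℕ} (x : Fin (m + 2) → X) (y : Fin n → X)
    (z t : X) :
    (0 : Fin (N + 1)).contractNth (fun _ _ => t) (argSeq (N + 1) x y z) =
      argSeq N (Fin.cons t fun i => x i.succ.succ : Fin (m + 1) → X) y z := by
  funext ⟨j, hj⟩
  rcases j with _ | j
  · rfl
  · simp [Fin.contractNth, argSeq, Fin.cons]

theorem contractNth_argSeq_right {X : Type v} {m n N : ℕ} (x : Fin m → X) (y : Fin (n + 2) → X)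
    (z t : X) (k : Fin (N + 1)) (hk : (k : ℕ) = m) :
    k.contractNth (fun _ _ => t) (argSeq (N + 1) x y z) =
      argSeq N x (Fin.cons t fun j => y j.succ.succ : Fin (n + 1) → X) z := by
  funext ⟨j, hj⟩
  rcases lt_trichotomy j m with h | rfl | h
  · simp [Fin.contractNth, argSeq, hk, h]
  · simp [Fin.contractNth, argSeq, hk]
  · obtain ⟨j, rfl⟩ := Nat.exists_eq_add_of_lt h
    have h₁ : m + j + 1 - m = j + 1 := by omega
    have h₂ : m + j + 1 + 1 - m = j + 2 := by omega
    have h₃ : ¬ m + j + 1 < m := by omega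
    have h₄ : ¬ m + j + 1 + 1 < m := by omega
    simp [Fin.contractNth, argSeq, Fin.cons, hk, h₁, h₂, h₃, h₄, h.ne']

theorem deviation_succ {n : ℕ} {α : (i : Fin (n + 1)) → Fin ((i : ℕ) + 3)} {a : Fin (n + 4) → L}
    {k : Fin (n + 3)} (hk : α (Fin.last n) = k) {A : L → L} (hA : ∀ t, A t = deviation n
      (fun i => α i.castSucc) (k.castSucc.contractNth (fun _ _ => t) a)) :
    deviation (n + 1) α a = iterDeviation A (a k.castSucc) [a k.succ] := by
  subst hk
  rw [funext hA]
  rfl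

theorem deviationP_add_two_one (m : ℕ) (x : Fin (m + 2) → L) (y : Fin 1 → L) (z : L) :
    deviationP (m + 2) 1 x y z = iterDeviation
      (fun t => deviationP (m + 1) 1 (Fin.cons t fun i => x i.succ.succ) y z) (x 0) [x 1] := by
  refine deviation_succ (k := (0 : Fin (m + 3))) (dif_pos (Nat.lt_succ_self m)) fun t => ?_
  refine congrArg₂ (deviation m) (funext fun i => ?_) (contractNth_argSeq_left x y z t).symm
  have hi : (i.castSucc : ℕ) < m + 2 - 1 := i.castSucc.is_lt
  refine (dif_pos i.is_lt).trans (Eq.symm ?_)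
  exact dif_pos hi

theorem deviationP_add_two (m n : ℕ) (x : Fin (m + 1) → L) (y : Fin (n + 2) → L) (z : L) :
    deviationP (m + 1) (n + 2) x y z = iterDeviation
      (fun t => deviationP (m + 1) (n + 1) x (Fin.cons t fun j => y j.succ.succ) z)
      (y 0) [y 1] := by
  let k : Fin (m + n + 3) := ⟨m + 1, by omega⟩
  have first : argSeq (m + n + 4) x y z k.castSucc = y 0 := by simp [argSeq, k]
  have second : argSeq (m + n + 4) x y z k.succ = y 1 := by simp [argSeq, k]
  rw [← first, ← second]
  exact deviation_succ (dif_neg (by simp)) fun t =>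
    congrArg (deviation (m + n) _) (contractNth_argSeq_right x y z t k.castSucc rfl).symm

theorem deviationP_one_one (x y : Fin 1 → L) (z : L) :
    deviationP 1 1 x y z = loopAssociator (x 0) (y 0) z := rfl

theorem deviationP_eq_iterDeviation_right (m n : ℕ) (x : Fin (m + 1) → L) (y : Fin (n + 1) → L)
    (z : L) :
    deviationP (m + 1) (n + 1) x y z =
      iterDeviation (fun v => deviationP (m + 1) 1 x (fun _ => v) z) (y 0)
        (List.ofFn fun j => y j.succ) := by
  induction n with
  | zero =>
    rw [List.ofFn_zero, iterDeviation]
    exact congrArg (deviationP (m + 1) 1 x · z) (funext fun j => congrArg y (Fin.fin_one_eq_zero j))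
  | succ n ih =>
    simp only [deviationP_add_two, List.ofFn_succ, iterDeviation, ih]
    rfl

theorem deviationP_eq_iterDeviation_left (m : ℕ) (x : Fin (m + 1) → L) (y z : L) :
    deviationP (m + 1) 1 x (fun _ => y) z =
      iterDeviation (fun u => loopAssociator u y z) (x 0) (List.ofFn fun i => x i.succ) := by
  induction m with
  | zero => rw [deviationP_one_one, List.ofFn_zero, iterDeviation]
  | succ m ih =>
    simp only [deviationP_add_two_one, List.ofFn_succ, iterDeviation, ih]
    rfl

theorem loopAssociator_eq_one {a b c : L} (h : a = 1 ∨ b = 1 ∨ c = 1) :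
    loopAssociator a b c = 1 := by
  rcases h with rfl | rfl | rfl <;> simp only [loopAssociator, one_mul, mul_one, ldiv_self]

theorem deviationP_eq_one {m n : ℕ} (hm : 1 ≤ m) (hn : 1 ≤ n) {x : Fin m → L} {y : Fin n → L}
    {z : L} (h : (∃ i, x i = 1) ∨ (∃ j, y j = 1) ∨ z = 1) : deviationP m n x y z = 1 := by
  obtain ⟨m, rfl⟩ := Nat.exists_eq_add_of_le' hm
  obtain ⟨n, rfl⟩ := Nat.exists_eq_add_of_le' hn
  have mem_iff {k : ℕ} (w : Fin (k + 1) → L) :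
      (∃ i, w i = 1) ↔ w 0 = 1 ∨ 1 ∈ List.ofFn fun i => w i.succ := by
    rw [Fin.exists_fin_succ, List.mem_ofFn']
    rfl
  rw [mem_iff, mem_iff] at h
  rw [deviationP_eq_iterDeviation_right]
  rcases h with h | h | rfl
  · refine iterDeviation_eq_one_of_forall (fun v => ?_) _ _
    rw [deviationP_eq_iterDeviation_left]
    exact iterDeviation_eq_one (A := fun u => loopAssociator u v z)
      (loopAssociator_eq_one (Or.inl rfl)) _ _ h
  · refine iterDeviation_eq_one ?_ _ _ h
    rw [deviationP_eq_iterDeviation_left]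
    exact iterDeviation_eq_one_of_forall
      (fun u => loopAssociator_eq_one (Or.inr (Or.inl rfl))) _ _
  · refine iterDeviation_eq_one_of_forall (fun v => ?_) _ _
    rw [deviationP_eq_iterDeviation_left]
    exact iterDeviation_eq_one_of_forall
      (fun u => loopAssociator_eq_one (Or.inr (Or.inr rfl))) _ _

section Homomorphisms

variable {K : Type v} [Loop K] (φ : L →* K)

theorem map_ldiv (a b : L) : φ (Loop.ldiv a b) = Loop.ldiv (φ a) (φ b) := by
  conv_rhs => rw [← Loop.mul_ldiv a b, map_mul, Loop.ldiv_mul]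

theorem map_loopAssociator (a b c : L) :
    φ (loopAssociator a b c) = loopAssociator (φ a) (φ b) (φ c) := by
  simp only [loopAssociator, map_ldiv, map_mul]

theorem map_deviation (n : ℕ) (α : (i : Fin n) → Fin ((i : ℕ) + 3)) (a : Fin (n + 3) → L) :
    φ (deviation n α a) = deviation n α fun i => φ (a i) := by
  induction n with
  | zero => simp only [deviation, map_loopAssociator]
  | succ n ih =>
    have map_contractNth (k : Fin (n + 3)) (t : L) :
        (fun i => φ (k.castSucc.contractNth (fun _ _ => t) a i)) =
          k.castSucc.contractNth (fun _ _ => φ t) fun i => φ (a i) :=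
      Fin.comp_contractNth _ _ (fun _ _ => rfl) _ _
    simp only [deviation, map_ldiv, map_mul, ih, map_contractNth]

theorem map_deviationP (m n : ℕ) (x : Fin m → L) (y : Fin n → L) (z : L) :
    φ (deviationP m n x y z) = deviationP m n (fun i => φ (x i)) (fun j => φ (y j)) (φ z) := by
  rw [deviationP, map_deviation, deviationP]
  refine congrArg (deviation _ _) (funext fun j => ?_)
  split_ifs <;> rfl

end Homomorphisms

end Deviations

section Homomorphisms

variable {A : Type u} {B : Type v} [NonAssocRing A] [NonAssocRing B]

theorem leftProd_succ {r : ℕ} (x : Fin (r + 1) → A) :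
    leftProd x = leftProd (fun i => x i.castSucc) * x (Fin.last r) := by
  simp only [leftProd, List.ofFn_succ_last, List.foldl_append, List.foldl_cons, List.foldl_nil]

theorem map_leftProd (φ : A →+* B) {r : ℕ} (x : Fin r → A) :
    φ (leftProd x) = leftProd fun i => φ (x i) := by
  induction r with
  | zero => exact map_one φ
  | succ r ih => rw [leftProd_succ, leftProd_succ, map_mul, ih]

theorem map_primOp (φ : A →+* B) (r s : ℕ) (x : Fin r → A) (y : Fin s → A) (z : A) :
    φ (primOp r s x y z) = primOp r s (fun i => φ (x i)) (fun j => φ (y j)) (φ z) := by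
  induction hn : r + s using Nat.strong_induction_on generalizing r s with
  | _ n ih =>
    rw [primOp, primOp]
    simp only [map_sub, map_sum, map_mul, map_leftProd]
    refine congrArg _ (Finset.sum_congr rfl fun I _ => Finset.sum_congr rfl fun J _ => ?_)
    split_ifs with h
    · rw [map_mul, map_mul, map_leftProd, map_leftProd, ih _ (hn ▸ h) _ _ _ _ rfl]
      rfl
    · exact map_zero φ

end Homomorphisms

namespace Monomial

variable {V : Type u}

/-- The letters of a monomial, with multiplicities: its multidegree. -/
def letters (w : Monomial V) : Multiset V :=
  (WithOne.lift (FreeMagma.lift fun v => Multiplicative.ofAdd ({v} : Multiset V)) w).toAdd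

theorem letters_one : letters (1 : Monomial V) = 0 := rfl

theorem letters_of (v : V) : letters (FreeMagma.of v : Monomial V) = {v} := rfl

theorem letters_mul (a b : Monomial V) : letters (a * b) = letters a + letters b := by
  rw [letters, map_mul, toAdd_mul, letters, letters]

theorem card_letters (w : Monomial V) : w.letters.card = w.degree := by
  cases w using WithOne.recOneCoe with
  | one => rfl
  | coe w =>
    induction w using FreeMagma.rec with
    | of v => rfl
    | mul s t hs ht =>
      change (letters ((s : Monomial V) * (t : Monomial V))).card = s.length + t.length
      rw [letters_mul, Multiset.card_add, hs, ht]
      rfl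

end Monomial

namespace NAPowerSeries

open Monomial
open scoped Pointwise

variable {V : Type u} {R : Type v} [CommRing R]

section Coefficients

theorem coeff_neg (w : Monomial V) (f : NAPowerSeries V R) : coeff w (-f) = -coeff w f := rfl

theorem coeff_sub (w : Monomial V) (f g : NAPowerSeries V R) :
    coeff w (f - g) = coeff w f - coeff w g := rfl

theorem coeff_sum {ι : Type w} (w : Monomial V) (s : Finset ι) (f : ι → NAPowerSeries V R) :
    coeff w (∑ i ∈ s, f i) = ∑ i ∈ s, coeff w (f i) :=
  map_sum (AddMonoidHom.mk' (coeff w) (coeff_add w)) f s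

theorem coeff_eq_zero_of_ne_one {w : Monomial V} (h : w ≠ 1) :
    coeff w (1 : NAPowerSeries V R) = 0 := if_neg h

theorem coeff_X_self (v : V) : coeff (FreeMagma.of v : Monomial V) (X R v) = 1 := if_pos rfl

theorem coeff_X_of_ne {w : Monomial V} {v : V} (h : w ≠ (FreeMagma.of v : Monomial V)) :
    coeff w (X R v) = 0 := if_neg h

theorem coeff_one_X (v : V) : coeff 1 (X R v) = 0 := coeff_X_of_ne WithOne.one_ne_coe

theorem coeff_mul_eq_zero {w : Monomial V} {f g : NAPowerSeries V R}
    (h : ∀ a b, a * b = w → coeff a f * coeff b g = 0) : coeff w (f * g) = 0 := by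
  rw [coeff_mul]
  refine List.sum_eq_zero fun c hc => ?_
  obtain ⟨p, hp, rfl⟩ := List.mem_map.mp hc
  exact h _ _ ((mem_factorizations w p).mp hp)

end Coefficients

section Multidegrees

/-- The series in which only monomials with multidegree in `S` occur. For a singleton `S`, these
are the multihomogeneous series of that multidegree. -/
def supportedOn (R : Type v) [CommRing R] (S : Set (Multiset V)) :
    AddSubgroup (NAPowerSeries V R) where
  carrier := {f | ∀ w, letters w ∉ S → coeff w f = 0}
  zero_mem' _ _ := rfl
  add_mem' hf hg w hw := by rw [coeff_add, hf w hw, hg w hw, add_zero]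
  neg_mem' hf w hw := by rw [coeff_neg, hf w hw, neg_zero]

theorem mem_supportedOn {S : Set (Multiset V)} {f : NAPowerSeries V R} :
    f ∈ supportedOn R S ↔ ∀ w, letters w ∉ S → coeff w f = 0 := Iff.rfl

theorem supportedOn_mono {S T : Set (Multiset V)} (h : S ⊆ T) :
    supportedOn R S ≤ supportedOn R T := fun _ hf w hw => hf w fun hw' => hw (h hw')

theorem mul_mem_supportedOn {S T : Set (Multiset V)} {f g : NAPowerSeries V R}
    (hf : f ∈ supportedOn R S) (hg : g ∈ supportedOn R T) : f * g ∈ supportedOn R (S + T) := by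
  rintro _ hw
  refine coeff_mul_eq_zero ?_
  rintro a b rfl
  rw [letters_mul] at hw
  by_cases ha : letters a ∈ S
  · rw [hg b fun hb => hw (Set.add_mem_add ha hb), mul_zero]
  · rw [hf a ha, zero_mul]

theorem one_mem_supportedOn : (1 : NAPowerSeries V R) ∈ supportedOn R {0} :=
  fun _ hw => coeff_eq_zero_of_ne_one fun h => hw (h ▸ letters_one)

theorem X_mem_supportedOn (v : V) : X R v ∈ supportedOn R {{v}} :=
  fun _ hw => coeff_X_of_ne fun h => hw (h ▸ letters_of v)

theorem leftProd_mem_supportedOn {r : ℕ} {x : Fin r → NAPowerSeries V R}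
    {μ : Fin r → Multiset V} (hx : ∀ i, x i ∈ supportedOn R {μ i}) :
    leftProd x ∈ supportedOn R {∑ i, μ i} := by
  induction r with
  | zero => exact one_mem_supportedOn
  | succ r ih =>
    rw [leftProd_succ, Fin.sum_univ_castSucc, ← Set.singleton_add_singleton]
    exact mul_mem_supportedOn (ih fun i => hx i.castSucc) (hx (Fin.last r))

theorem primOp_mem_supportedOn {r s : ℕ} {x : Fin r → NAPowerSeries V R}
    {y : Fin s → NAPowerSeries V R} {z : NAPowerSeries V R} {μ : Fin r → Multiset V}
    {ν : Fin s → Multiset V} {ρ : Multiset V} (hx : ∀ i, x i ∈ supportedOn R {μ i})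
    (hy : ∀ j, y j ∈ supportedOn R {ν j}) (hz : z ∈ supportedOn R {ρ}) :
    primOp r s x y z ∈ supportedOn R {∑ i, μ i + ∑ j, ν j + ρ} := by
  induction hn : r + s using Nat.strong_induction_on generalizing r s with
  | _ n ih =>
    have hu := leftProd_mem_supportedOn hx
    have hv := leftProd_mem_supportedOn hy
    rw [primOp]
    refine sub_mem (sub_mem ?_ ?_) (sum_mem fun I _ => sum_mem fun J _ => ?_)
    · simpa only [Set.singleton_add_singleton] using
        mul_mem_supportedOn (mul_mem_supportedOn hu hv) hz
    · simpa only [Set.singleton_add_singleton, add_assoc] using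
        mul_mem_supportedOn hu (mul_mem_supportedOn hv hz)
    · split_ifs with h
      · have hu' := leftProd_mem_supportedOn (x := subseq x Iᶜ) fun i => hx _
        have hv' := leftProd_mem_supportedOn (x := subseq y Jᶜ) fun j => hy _
        have hp := ih _ (hn ▸ h) (x := subseq x I) (y := subseq y J) (fun i => hx _)
          (fun j => hy _) rfl
        have huvp := mul_mem_supportedOn (mul_mem_supportedOn hu' hv') hp
        simp only [sum_orderEmbOfFin, Set.singleton_add_singleton] at huvp
        rw [← Finset.sum_add_sum_compl I μ, ← Finset.sum_add_sum_compl J ν]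
        convert huvp using 2
        abel_nf
      · exact zero_mem _

theorem leftProdOn_X_mem_supportedOn {r : ℕ} (x : Fin r → V) (I : Finset (Fin r)) :
    leftProdOn (fun i => X R (x i)) I ∈ supportedOn R {∑ i ∈ I, {x i}} := by
  rw [← sum_orderEmbOfFin]
  exact leftProd_mem_supportedOn fun _ => X_mem_supportedOn _

theorem primOpOn_X_mem_supportedOn {r s : ℕ} (x : Fin r → V) (y : Fin s → V) (z : V)
    (I : Finset (Fin r)) (J : Finset (Fin s)) :
    primOpOn (fun i => X R (x i)) (fun j => X R (y j)) (X R z) I J ∈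
      supportedOn R {∑ i ∈ I, {x i} + ∑ j ∈ J, {y j} + {z}} := by
  rw [← sum_orderEmbOfFin I, ← sum_orderEmbOfFin J]
  exact primOp_mem_supportedOn (fun _ => X_mem_supportedOn _) (fun _ => X_mem_supportedOn _)
    (X_mem_supportedOn z)

theorem coeff_primOpOn_X_of_degree_ne {r s : ℕ} (x : Fin r → V) (y : Fin s → V) (z : V)
    (I : Finset (Fin r)) (J : Finset (Fin s)) {w : Monomial V}
    (hw : w.degree ≠ I.card + J.card + 1) :
    coeff w (primOpOn (fun i => X R (x i)) (fun j => X R (y j)) (X R z) I J) = 0 := by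
  refine mem_supportedOn.mp (primOpOn_X_mem_supportedOn x y z I J) w fun h => hw ?_
  rw [← card_letters, Set.mem_singleton_iff.mp h]
  simp only [Multiset.card_add, Multiset.card_sum, Multiset.card_singleton, Finset.sum_const,
    smul_eq_mul, mul_one]

theorem coeff_primOp_X_of_degree_ne {r s : ℕ} (x : Fin r → V) (y : Fin s → V) (z : V)
    {w : Monomial V} (hw : w.degree ≠ r + s + 1) :
    coeff w (primOp r s (fun i => X R (x i)) (fun j => X R (y j)) (X R z)) = 0 := by
  rw [← primOpOn_univ]
  exact coeff_primOpOn_X_of_degree_ne x y z _ _ (by simpa only [Finset.card_fin] using hw)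

end Multidegrees

section Nonvanishing

theorem coeff_one_leftProd_X {r : ℕ} (hr : r ≠ 0) (x : Fin r → V) :
    coeff 1 (leftProd fun i => X R (x i)) = 0 := by
  obtain ⟨r, rfl⟩ := Nat.exists_eq_succ_of_ne_zero hr
  rw [leftProd_succ, coeff_one_mul, coeff_one_X, mul_zero]

theorem exists_coeff_leftProd_X_eq_one {r : ℕ} (hr : r ≠ 0) (x : Fin r → V) :
    ∃ a : FreeMagma V, coeff (a : Monomial V) (leftProd fun i => X R (x i)) = 1 := by
  obtain ⟨r, rfl⟩ := Nat.exists_eq_succ_of_ne_zero hr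
  induction r with
  | zero =>
    refine ⟨.of (x 0), ?_⟩
    rw [leftProd_succ, leftProd, List.ofFn_zero, List.foldl_nil, one_mul]
    exact coeff_X_self (x 0)
  | succ r ih =>
    obtain ⟨a, ha⟩ := ih r.succ_ne_zero fun i => x i.castSucc
    refine ⟨a * .of (x (Fin.last _)), ?_⟩
    rw [leftProd_succ, coeff_mul_mul, ha, coeff_one_leftProd_X r.succ_ne_zero, coeff_one_X,
      coeff_X_self]
    ring

theorem coeff_mul_of_mul_X {u v : NAPowerSeries V R} (hu : coeff 1 u = 0) (hv : coeff 1 v = 0)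
    (a b : FreeMagma V) (z : V) :
    coeff ((a * b * .of z : FreeMagma V) : Monomial V) ((u * v) * X R z - u * (v * X R z)) =
      coeff (a : Monomial V) u * coeff (b : Monomial V) v := by
  simp only [coeff_sub, coeff_mul_mul, coeff_one_mul, coeff_of_mul, hu, hv, coeff_one_X,
    coeff_X_self]
  ring

theorem coeff_mul_primOpOn_X_eq_zero {r s : ℕ} (x : Fin r → V) (y : Fin s → V) (z : V)
    (I : Finset (Fin r)) (J : Finset (Fin s)) {f : NAPowerSeries V R} (hf : coeff 1 f = 0)
    (a : FreeMagma V) (v : V) :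
    coeff ((a * .of v : FreeMagma V) : Monomial V)
      (f * primOpOn (fun i => X R (x i)) (fun j => X R (y j)) (X R z) I J) = 0 := by
  rcases I.eq_empty_or_nonempty with rfl | hI
  · rw [primOpOn_empty_left, mul_zero, coeff_zero]
  · have hcard := hI.card_pos
    have hone : Monomial.degree (1 : Monomial V) ≠ I.card + J.card + 1 :=
      (Nat.succ_ne_zero _).symm
    have hof : Monomial.degree (FreeMagma.of v : Monomial V) ≠ I.card + J.card + 1 := by
      change 1 ≠ _
      omega
    rw [coeff_mul_mul, hf, coeff_primOpOn_X_of_degree_ne x y z I J hone,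
      coeff_primOpOn_X_of_degree_ne x y z I J hof]
    ring

theorem primOp_X_ne_zero [Nontrivial R] {r s : ℕ} (hr : r ≠ 0) (hs : s ≠ 0) (x : Fin r → V)
    (y : Fin s → V) (z : V) :
    primOp r s (fun i => X R (x i)) (fun j => X R (y j)) (X R z) ≠ 0 := by
  obtain ⟨a, ha⟩ := exists_coeff_leftProd_X_eq_one (R := R) hr x
  obtain ⟨b, hb⟩ := exists_coeff_leftProd_X_eq_one (R := R) hs y
  have hcoeff := coeff_mul_of_mul_X (coeff_one_leftProd_X (R := R) hr x)
    (coeff_one_leftProd_X hs y) a b z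
  intro h
  -- In the defining identity only the term `p_{r,s}(x; y; z)` can contain the monomial `(ab)z`.
  rw [ha, hb, mul_one, primOp_identity, coeff_sum, Finset.sum_eq_zero] at hcoeff
  · exact zero_ne_one hcoeff
  refine fun I _ => (coeff_sum _ _ _).trans (Finset.sum_eq_zero fun J _ => ?_)
  by_cases hIJ : I = Finset.univ ∧ J = Finset.univ
  · obtain ⟨rfl, rfl⟩ := hIJ
    rw [← primOpOn, primOpOn_univ, h, mul_zero, coeff_zero]
  have card_compl_ne_zero {k : ℕ} {K : Finset (Fin k)} (hK : K ≠ Finset.univ) : Kᶜ.card ≠ 0 :=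
    by rwa [ne_eq, Finset.card_eq_zero, Finset.compl_eq_empty_iff]
  refine coeff_mul_primOpOn_X_eq_zero x y z I J ?_ (a * b) z
  rw [coeff_one_mul]
  rcases not_and_or.mp hIJ with hI | hJ
  · exact mul_eq_zero_of_left (coeff_one_leftProd_X (card_compl_ne_zero hI) _) _
  · exact mul_eq_zero_of_right _ (coeff_one_leftProd_X (card_compl_ne_zero hJ) _)

end Nonvanishing

end NAPowerSeries

namespace NAPowerSeries

open Monomial
open scoped Pointwise

variable {V : Type u} {R : Type v} [CommRing R]

section LetterIdeals

/-- The two-sided ideal of the series all of whose monomials have multidegree in `S`. -/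
noncomputable def letterIdeal (R : Type v) [CommRing R] (S : UpperSet (Multiset V)) :
    TwoSidedIdeal (NAPowerSeries V R) :=
  .mk' (supportedOn R (S : Set (Multiset V))) (zero_mem _) add_mem neg_mem
    (fun {_ _} hg => supportedOn_mono
      (Set.add_subset_iff.mpr fun _ _ _ hν => S.upper le_add_self hν)
      (mul_mem_supportedOn (S := Set.univ) (fun _ h => absurd trivial h) hg))
    (fun {_ _} hf => supportedOn_mono
      (Set.add_subset_iff.mpr fun _ hμ _ _ => S.upper le_self_add hμ)
      (mul_mem_supportedOn (T := Set.univ) hf fun _ h => absurd trivial h))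

theorem mem_letterIdeal {S : UpperSet (Multiset V)} {f : NAPowerSeries V R} :
    f ∈ letterIdeal R S ↔ ∀ w, letters w ∉ S → coeff w f = 0 :=
  (TwoSidedIdeal.mem_mk' ..).trans mem_supportedOn

theorem mem_letterIdeal_of_mul_mem {S : UpperSet (Multiset V)} {a f : NAPowerSeries V R}
    (ha : coeff 1 a = 1) (h : a * f ∈ letterIdeal R S) : f ∈ letterIdeal R S := by
  rw [mem_letterIdeal] at h ⊢
  intro w hw
  have hzero : coeff 1 f = 0 := by
    simpa only [coeff_one_mul, ha, one_mul] using
      h 1 fun hS => hw (S.upper (Multiset.zero_le _) hS)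
  cases w using WithOne.recOneCoe with
  | one => exact hzero
  | coe w =>
    induction w using FreeMagma.rec with
    | of v => simpa only [coeff_of_mul, ha, hzero, one_mul, mul_zero, add_zero] using h _ hw
    | mul s t _ ih =>
      have ht : coeff (t : Monomial V) f = 0 :=
        ih fun hS => hw (S.upper (le_add_self.trans_eq (letters_mul (s : Monomial V) t).symm) hS)
      have hst : coeff ((s * t : FreeMagma V) : Monomial V) (a * f) = 0 := h _ hw
      change coeff ((s * t : FreeMagma V) : Monomial V) f = 0
      simpa only [coeff_mul_mul, ha, hzero, ht, one_mul, mul_zero, add_zero] using hst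

/-- The ideal of the series all of whose monomials contain the letter `v`. -/
noncomputable def involving (R : Type v) [CommRing R] (v : V) : TwoSidedIdeal (NAPowerSeries V R) :=
  letterIdeal R ⟨{μ | v ∈ μ}, fun _ _ h hv => Multiset.mem_of_le h hv⟩

/-- The ideal of the series all of whose monomials contain some letter at least twice. -/
noncomputable def repeating (V : Type u) (R : Type v) [CommRing R] :
    TwoSidedIdeal (NAPowerSeries V R) :=
  letterIdeal R ⟨{μ | ¬ μ.Nodup}, fun _ _ h hμ hν => hμ (Multiset.nodup_of_le h hν)⟩

theorem mem_involving {v : V} {f : NAPowerSeries V R} :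
    f ∈ involving R v ↔ ∀ w, v ∉ letters w → coeff w f = 0 := mem_letterIdeal

theorem mem_repeating {f : NAPowerSeries V R} :
    f ∈ repeating V R ↔ ∀ w, (letters w).Nodup → coeff w f = 0 := by
  refine mem_letterIdeal.trans (forall_congr' fun w => ?_)
  exact imp_congr_left not_not

theorem mem_involving_of_mem_supportedOn {v : V} {μ : Multiset V} {f : NAPowerSeries V R}
    (hf : f ∈ supportedOn R {μ}) (hv : v ∈ μ) : f ∈ involving R v :=
  mem_involving.mpr fun w hw => hf w fun h => hw (Set.mem_singleton_iff.mp h ▸ hv)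

theorem mul_mem_repeating {v : V} {f g : NAPowerSeries V R} (hf : f ∈ involving R v)
    (hg : g ∈ involving R v) : f * g ∈ repeating V R := by
  rw [mem_involving] at hf hg
  rw [mem_repeating]
  refine fun w hw => coeff_mul_eq_zero fun a b hab => ?_
  rw [← hab, letters_mul, Multiset.nodup_add] at hw
  by_cases ha : v ∈ letters a
  · rw [hg b fun hb => Multiset.disjoint_left.mp hw.2.2 ha hb, mul_zero]
  · rw [hf a ha, zero_mul]

theorem coeff_eq_zero_of_degree_le_card [Fintype V] {f : NAPowerSeries V R}
    (hf : ∀ v, f ∈ involving R v) (hf' : f ∈ repeating V R) {w : Monomial V}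
    (hw : w.degree ≤ Fintype.card V) : coeff w f = 0 := by
  by_cases h : ∀ v, v ∈ letters w
  · have hle : (Finset.univ : Finset V).val ≤ letters w :=
      (Multiset.le_iff_subset Finset.univ.nodup).mpr fun v _ => h v
    have huniv := Multiset.eq_of_le_of_card_le hle ((card_letters w).trans_le hw)
    exact mem_repeating.mp hf' w (huniv ▸ Finset.univ.nodup)
  · obtain ⟨v, hv⟩ := not_forall.mp h
    exact mem_involving.mp (hf v) w hv

theorem X_mem_involving (v : V) : X R v ∈ involving R v :=
  mem_involving_of_mem_supportedOn (X_mem_supportedOn v) (Multiset.mem_singleton_self v)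

theorem leftProdOn_X_mem_involving {r : ℕ} (x : Fin r → V) {I : Finset (Fin r)} {i : Fin r}
    (hi : i ∈ I) : leftProdOn (fun i => X R (x i)) I ∈ involving R (x i) :=
  mem_involving_of_mem_supportedOn (leftProdOn_X_mem_supportedOn x I)
    (Multiset.mem_sum.mpr ⟨i, hi, Multiset.mem_singleton_self _⟩)

section PrimitiveOperations

variable {r s : ℕ} (x : Fin r → V) (y : Fin s → V) (z : V) {I : Finset (Fin r)}
  {J : Finset (Fin s)}

theorem primOpOn_X_mem_involving_left {i : Fin r} (hi : i ∈ I) :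
    primOpOn (fun i => X R (x i)) (fun j => X R (y j)) (X R z) I J ∈ involving R (x i) :=
  mem_involving_of_mem_supportedOn (primOpOn_X_mem_supportedOn x y z I J) <|
    Multiset.mem_add.mpr <| .inl <| Multiset.mem_add.mpr <| .inl <|
      Multiset.mem_sum.mpr ⟨i, hi, Multiset.mem_singleton_self _⟩

theorem primOpOn_X_mem_involving_right {j : Fin s} (hj : j ∈ J) :
    primOpOn (fun i => X R (x i)) (fun j => X R (y j)) (X R z) I J ∈ involving R (y j) :=
  mem_involving_of_mem_supportedOn (primOpOn_X_mem_supportedOn x y z I J) <|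
    Multiset.mem_add.mpr <| .inl <| Multiset.mem_add.mpr <| .inr <|
      Multiset.mem_sum.mpr ⟨j, hj, Multiset.mem_singleton_self _⟩

theorem primOpOn_X_mem_involving_last (I : Finset (Fin r)) (J : Finset (Fin s)) :
    primOpOn (fun i => X R (x i)) (fun j => X R (y j)) (X R z) I J ∈ involving R z :=
  mem_involving_of_mem_supportedOn (primOpOn_X_mem_supportedOn x y z I J) <|
    Multiset.mem_add.mpr <| .inr <| Multiset.mem_singleton_self z

end PrimitiveOperations

end LetterIdeals

section ModuloRepetitions

/-- The projection onto the algebra of power series modulo monomials with repeated letters. -/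
noncomputable def modRepeating (V : Type u) (R : Type v) [CommRing R] :
    NAPowerSeries V R →+* (repeating V R).ringCon.Quotient :=
  (repeating V R).ringCon.mk'

theorem modRepeating_eq_iff {f g : NAPowerSeries V R} :
    modRepeating V R f = modRepeating V R g ↔ f - g ∈ repeating V R :=
  (RingCon.eq _).trans (TwoSidedIdeal.rel_iff _ f g)

theorem modRepeating_mul_eq_zero {v : V} {f g : NAPowerSeries V R} (hf : f ∈ involving R v)
    (hg : g ∈ involving R v) : modRepeating V R f * modRepeating V R g = 0 := by
  rw [← map_mul, ← map_zero (modRepeating V R), modRepeating_eq_iff, sub_zero]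
  exact mul_mem_repeating hf hg

theorem modRepeating_ldiv {a b : UnitSeries V R} {f : NAPowerSeries V R}
    (h : modRepeating V R a.1 * modRepeating V R f = modRepeating V R b.1) :
    modRepeating V R (Loop.ldiv a b).1 = modRepeating V R f := by
  rw [← Loop.mul_ldiv a b, ← map_mul, eq_comm, UnitSeries.val_mul, modRepeating_eq_iff,
    ← mul_sub] at h
  exact modRepeating_eq_iff.mpr (mem_letterIdeal_of_mul_mem a.2 h)

theorem modRepeating_ldiv_mul {z : V} {a b c : UnitSeries V R} {f g h : NAPowerSeries V R}
    (ha : modRepeating V R a.1 = modRepeating V R (1 + f))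
    (hb : modRepeating V R b.1 = modRepeating V R (1 + g))
    (hc : modRepeating V R c.1 = modRepeating V R (1 + h)) (hf : f ∈ involving R z)
    (hg : g ∈ involving R z) (hh : h ∈ involving R z) :
    modRepeating V R (Loop.ldiv (a * b) c).1 = modRepeating V R (1 + (h - f - g)) := by
  have hhfg := sub_mem (sub_mem hh hf) hg
  refine modRepeating_ldiv ?_
  rw [UnitSeries.val_mul, map_mul, ha, hb, hc]
  calc modRepeating V R (1 + f) * modRepeating V R (1 + g) * modRepeating V R (1 + (h - f - g))
    _ = modRepeating V R (1 + (f + g)) * modRepeating V R (1 + (h - f - g)) := by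
      simp only [map_add, map_one, add_mul, mul_add, one_mul, mul_one,
        modRepeating_mul_eq_zero hf hg, add_zero, add_assoc]
    _ = modRepeating V R (1 + (f + g)) + modRepeating V R (h - f - g) := by
      rw [map_add _ 1 (h - f - g), map_one, mul_add, mul_one, map_add _ 1 (f + g), map_one,
        add_mul, one_mul, modRepeating_mul_eq_zero (add_mem hf hg) hhfg, add_zero]
    _ = modRepeating V R (1 + h) := by
      rw [← map_add]
      congr 1
      abel

end ModuloRepetitions

end NAPowerSeries

namespace UnitSeries

open NAPowerSeries

variable {V : Type u} {R : Type v} [CommRing R]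

/-- The series `1 + x'`, the value of the Magnus expansion at the generator `x`. -/
noncomputable def oneAddX (R : Type v) [CommRing R] (v : V) : UnitSeries V R :=
  magnusHom V R (FreeLoop.of v)

theorem val_oneAddX (v : V) : (oneAddX R v).1 = 1 + X R v := rfl

section Associators

variable {r s : ℕ} (x : Fin r → V) (y : Fin s → V) (z : V) (I : Finset (Fin r))
  (J : Finset (Fin s))

/-- The sum of the `p(u; v; z)` over all subsequences `u`, `v` of the letters with places in `I`
and in `J`. -/
noncomputable def primOpSum (R : Type v) [CommRing R] : NAPowerSeries V R :=
  ∑ S ∈ I.powerset, ∑ T ∈ J.powerset,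
    primOpOn (fun i => X R (x i)) (fun j => X R (y j)) (X R z) S T

theorem primOpSum_mem_involving : primOpSum x y z I J R ∈ involving R z :=
  sum_mem fun S _ => sum_mem fun T _ => primOpOn_X_mem_involving_last x y z S T

theorem modRepeating_mul_primOpOn_eq_zero (S' S : Finset (Fin r)) (T' T : Finset (Fin s))
    (h : ¬ Disjoint S' S ∨ ¬ Disjoint T' T) :
    modRepeating V R ((leftProdOn (fun i => X R (x i)) S' * leftProdOn (fun j => X R (y j)) T') *
      primOpOn (fun i => X R (x i)) (fun j => X R (y j)) (X R z) S T) = 0 := by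
  rw [map_mul]
  rcases h with h | h
  · obtain ⟨i, hi', hi⟩ := Finset.not_disjoint_iff.mp h
    exact modRepeating_mul_eq_zero
      (TwoSidedIdeal.mul_mem_right _ _ _ (leftProdOn_X_mem_involving x hi'))
      (primOpOn_X_mem_involving_left x y z hi)
  · obtain ⟨j, hj', hj⟩ := Finset.not_disjoint_iff.mp h
    exact modRepeating_mul_eq_zero
      (TwoSidedIdeal.mul_mem_left _ _ _ (leftProdOn_X_mem_involving y hj'))
      (primOpOn_X_mem_involving_right x y z hj)

theorem modRepeating_associator {u v : NAPowerSeries V R}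
    (hu : u = leftProdOn (fun i => 1 + X R (x i)) I)
    (hv : v = leftProdOn (fun j => 1 + X R (y j)) J) :
    modRepeating V R ((u * v) * X R z - u * (v * X R z)) =
      modRepeating V R ((u * v) * primOpSum x y z I J R) := by
  let G (K S : Finset (Fin r)) (M T : Finset (Fin s)) := modRepeating V R
    ((leftProdOn (fun i => X R (x i)) K * leftProdOn (fun j => X R (y j)) M) *
      primOpOn (fun i => X R (x i)) (fun j => X R (y j)) (X R z) S T)
  have hG (K S) (M T) (h : ¬ Disjoint K S ∨ ¬ Disjoint M T) : G K S M T = 0 :=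
    modRepeating_mul_primOpOn_eq_zero x y z K S M T h
  rw [leftProdOn_one_add] at hu hv
  calc modRepeating V R ((u * v) * X R z - u * (v * X R z))
    _ = ∑ K ∈ I.powerset, ∑ M ∈ J.powerset, ∑ S ∈ K.powerset, ∑ T ∈ M.powerset,
        G (K \ S) S (M \ T) T := by
      simp only [hu, hv, Finset.sum_mul_sum]
      simp only [Finset.sum_mul]
      simp only [Finset.mul_sum, ← Finset.sum_sub_distrib, primOpOn_identity, map_sum, G]
    _ = ∑ K ∈ I.powerset, ∑ S ∈ K.powerset, ∑ M ∈ J.powerset, ∑ T ∈ J.powerset,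
        G (K \ S) S M T := by
      refine Finset.sum_congr rfl fun K _ => ?_
      rw [Finset.sum_comm]
      exact Finset.sum_congr rfl fun S _ => sum_powerset_sdiff (fun M T => G (K \ S) S M T)
        (fun M T h => hG _ _ _ _ (Or.inr h)) J
    _ = ∑ K ∈ I.powerset, ∑ S ∈ I.powerset, ∑ M ∈ J.powerset, ∑ T ∈ J.powerset, G K S M T :=
      sum_powerset_sdiff (fun K S => ∑ M ∈ J.powerset, ∑ T ∈ J.powerset, G K S M T)
        (fun K S h => Finset.sum_eq_zero fun M _ => Finset.sum_eq_zero fun T _ =>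
          hG _ _ _ _ (Or.inl h)) I
    _ = modRepeating V R ((u * v) * primOpSum x y z I J R) := by
      simp only [hu, hv, primOpSum, Finset.sum_mul_sum, map_sum, G]

theorem modRepeating_loopAssociator {t t' : UnitSeries V R}
    (ht : t.1 = leftProdOn (fun i => 1 + X R (x i)) I)
    (ht' : t'.1 = leftProdOn (fun j => 1 + X R (y j)) J) :
    modRepeating V R (loopAssociator t t' (oneAddX R z)).1 =
      modRepeating V R (1 + primOpSum x y z I J R) := by
  have hassoc := modRepeating_associator x y z I J ht ht'
  have hrep : modRepeating V R (t.1 * (t'.1 * X R z) * primOpSum x y z I J R) = 0 := by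
    rw [map_mul]
    exact modRepeating_mul_eq_zero (TwoSidedIdeal.mul_mem_left _ _ _
      (TwoSidedIdeal.mul_mem_left _ _ _ (X_mem_involving z))) (primOpSum_mem_involving x y z I J)
  refine modRepeating_ldiv ?_
  rw [← map_mul]
  simp only [UnitSeries.val_mul, val_oneAddX, mul_add, mul_one, add_mul]
  rw [map_sub, sub_eq_iff_eq_add] at hassoc
  simp only [map_add, hrep, hassoc]
  abel

end Associators

section Deviations

theorem modRepeating_iterDeviation {r : ℕ} (x : Fin r → V) (z : V)
    {F : Finset (Fin r) → NAPowerSeries V R} (hF : ∀ S, F S ∈ involving R z)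
    {A : UnitSeries V R → UnitSeries V R}
    (hA : ∀ t I, t.1 = leftProdOn (fun i => 1 + X R (x i)) I →
      modRepeating V R (A t).1 = modRepeating V R (1 + ∑ S ∈ I.powerset.erase ∅, F S))
    (l : List (Fin r)) (hl : l.Pairwise (· < ·)) (t : UnitSeries V R) (I : Finset (Fin r))
    (hI : ∀ i ∈ I, ∀ j ∈ l, i < j) (ht : t.1 = leftProdOn (fun i => 1 + X R (x i)) I) :
    modRepeating V R (iterDeviation A t (l.map fun i => oneAddX R (x i))).1 =
      modRepeating V R (1 + ∑ S ∈ I.powerset.erase ∅, F (S ∪ l.toFinset)) := by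
  induction l generalizing t I with
  | nil =>
    simp only [List.toFinset_nil, Finset.union_empty]
    exact hA t I ht
  | cons a l ih =>
    obtain ⟨ha, hl⟩ := List.pairwise_cons.mp hl
    have hIa (i) (hi : i ∈ I) : i < a := hI i hi a List.mem_cons_self
    have ht_single : (oneAddX R (x a)).1 = leftProdOn (fun i => 1 + X R (x i)) {a} := by
      rw [leftProdOn_singleton, val_oneAddX]
    have ht_insert :
        (t * oneAddX R (x a)).1 = leftProdOn (fun i => 1 + X R (x i)) (insert a I) := by
      rw [UnitSeries.val_mul, ht, val_oneAddX, leftProdOn_insert _ hIa]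
    have hlt_insert (i) (hi : i ∈ insert a I) (j) (hj : j ∈ l) : i < j := by
      rcases Finset.mem_insert.mp hi with rfl | hi
      · exact ha j hj
      · exact hI i hi j (List.mem_cons_of_mem a hj)
    have hsingle : ({a} : Finset (Fin r)).powerset.erase ∅ = {{a}} := rfl
    rw [List.map_cons, iterDeviation, modRepeating_ldiv_mul
      (ih hl t I (fun i hi j hj => hI i hi j (List.mem_cons_of_mem a hj)) ht)
      (ih hl _ _ (by simpa only [Finset.mem_singleton, forall_eq] using ha) ht_single)
      (ih hl _ _ hlt_insert ht_insert) (sum_mem fun _ _ => hF _) (sum_mem fun _ _ => hF _)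
      (sum_mem fun _ _ => hF _), hsingle, Finset.sum_singleton,
      sum_powerset_insert_erase_empty (fun S => F (S ∪ l.toFinset)) fun h => (hIa a h).false]
    simp only [List.toFinset_cons, Finset.union_insert, Finset.insert_union]

theorem modRepeating_iterDeviation_univ {r : ℕ} (x : Fin (r + 1) → V) (z : V)
    {F : Finset (Fin (r + 1)) → NAPowerSeries V R} (hF : ∀ S, F S ∈ involving R z)
    {A : UnitSeries V R → UnitSeries V R}
    (hA : ∀ t I, t.1 = leftProdOn (fun i => 1 + X R (x i)) I →
      modRepeating V R (A t).1 = modRepeating V R (1 + ∑ S ∈ I.powerset.erase ∅, F S)) :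
    modRepeating V R (iterDeviation A (oneAddX R (x 0))
      (List.ofFn fun i => oneAddX R (x i.succ))).1 = modRepeating V R (1 + F Finset.univ) := by
  have hsorted : (List.ofFn (Fin.succ : Fin r → Fin (r + 1))).Pairwise (· < ·) :=
    List.pairwise_ofFn.mpr fun _ _ h => Fin.succ_lt_succ_iff.mpr h
  have huniv : {0} ∪ (List.ofFn (Fin.succ : Fin r → Fin (r + 1))).toFinset = Finset.univ := by
    ext i
    cases i using Fin.cases <;> simp [List.mem_ofFn']
  have hsingle : ({0} : Finset (Fin (r + 1))).powerset.erase ∅ = {{0}} := rfl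
  have hone : (oneAddX R (x 0)).1 = leftProdOn (fun i => 1 + X R (x i)) {0} := by
    rw [leftProdOn_singleton, val_oneAddX]
  have hmap : List.ofFn (fun i => oneAddX R (x i.succ)) =
      (List.ofFn Fin.succ).map fun i => oneAddX R (x i) := by
    rw [List.map_ofFn]
    rfl
  have hlt (i : Fin (r + 1)) (hi : i ∈ ({0} : Finset (Fin (r + 1)))) (j : Fin (r + 1))
      (hj : j ∈ List.ofFn (Fin.succ : Fin r → Fin (r + 1))) : i < j := by
    obtain ⟨k, rfl⟩ := List.mem_ofFn.mp hj
    exact Finset.mem_singleton.mp hi ▸ k.succ_pos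
  rw [hmap, modRepeating_iterDeviation x z hF hA _ hsorted _ {0} hlt hone, hsingle,
    Finset.sum_singleton, huniv]

theorem modRepeating_deviationP (m n : ℕ) (x : Fin (m + 1) → V) (y : Fin (n + 1) → V) (z : V) :
    modRepeating V R (deviationP (m + 1) (n + 1) (fun i => oneAddX R (x i))
        (fun j => oneAddX R (y j)) (oneAddX R z)).1 =
      modRepeating V R
        (1 + primOp (m + 1) (n + 1) (fun i => X R (x i)) (fun j => X R (y j)) (X R z)) := by
  rw [deviationP_eq_iterDeviation_right, ← primOpOn_univ]
  refine modRepeating_iterDeviation_univ y z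
    (F := primOpOn (fun i => X R (x i)) (fun j => X R (y j)) (X R z) Finset.univ)
    (fun T => primOpOn_X_mem_involving_last x y z _ T) fun t' J ht' => ?_
  rw [deviationP_eq_iterDeviation_left]
  refine modRepeating_iterDeviation_univ x z
    (F := fun S => ∑ T ∈ J.powerset.erase ∅,
      primOpOn (fun i => X R (x i)) (fun j => X R (y j)) (X R z) S T)
    (fun S => sum_mem fun T _ => primOpOn_X_mem_involving_last x y z S T) fun t I ht => ?_
  rw [modRepeating_loopAssociator x y z I J ht ht', primOpSum]
  simp only [Finset.sum_erase, primOpOn_empty_left, primOpOn_empty_right, Finset.sum_const_zero]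

end Deviations

end UnitSeries

section LetterSubstitution

variable {S : Type w} {V : Type u}

/-- The words obtained from a word by replacing each letter `v` by an element of `P v`; they index
the coefficients of a series that contribute to a given coefficient after a substitution. -/
def replacements (P : V → Finset S) : FreeMagma V → Finset (FreeMagma S)
  | .of v => (P v).map ⟨.of, fun _ _ h => by injection h⟩
  | .mul a b => (replacements P a ×ˢ replacements P b).map
      ⟨fun p => p.1 * p.2, fun _ _ h => by injection h; exact Prod.ext ‹_› ‹_›⟩

theorem sum_replacements_of {M : Type v} [AddCommMonoid M] (P : V → Finset S) (v : V)
    (F : FreeMagma S → M) : ∑ b ∈ replacements P (.of v), F b = ∑ s ∈ P v, F (.of s) :=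
  Finset.sum_map ..

theorem sum_replacements_mul {M : Type v} [AddCommMonoid M] (P : V → Finset S) (a b : FreeMagma V)
    (F : FreeMagma S → M) :
    ∑ c ∈ replacements P (a * b), F c =
      ∑ c ∈ replacements P a, ∑ d ∈ replacements P b, F (c * d) :=
  (Finset.sum_map ..).trans (Finset.sum_product ..)

theorem length_of_mem_replacements {P : V → Finset S} {a : FreeMagma V} {b : FreeMagma S}
    (hb : b ∈ replacements P a) : b.length = a.length := by
  induction a using FreeMagma.rec generalizing b with
  | of v =>
    obtain ⟨s, -, rfl⟩ := Finset.mem_map.mp hb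
    rfl
  | mul a a' ih ih' =>
    obtain ⟨⟨c, d⟩, hp, rfl⟩ := Finset.mem_map.mp hb
    obtain ⟨hc, hd⟩ := Finset.mem_product.mp hp
    exact congrArg₂ (· + ·) (ih hc) (ih' hd)

theorem of_mem_replacements_iff {P : V → Finset S} {a : FreeMagma V} {s : S} :
    .of s ∈ replacements P a ↔ ∃ v, a = .of v ∧ s ∈ P v := by
  cases a with
  | of v =>
    refine Finset.mem_map.trans ⟨?_, ?_⟩
    · rintro ⟨_, hs, ⟨⟩⟩
      exact ⟨v, rfl, hs⟩
    · rintro ⟨_, ⟨⟩, hs⟩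
      exact ⟨s, hs, rfl⟩
  | mul a b =>
    refine iff_of_false (fun h => ?_) fun ⟨_, h, _⟩ => nomatch h
    obtain ⟨p, -, hp⟩ := Finset.mem_map.mp h
    exact nomatch hp

theorem replacements_eq_singleton {P : V → Finset V} {a : FreeMagma V}
    (h : ∀ v ∈ Monomial.letters (a : Monomial V), P v = {v}) : replacements P a = {a} := by
  induction a using FreeMagma.rec with
  | of v => rw [replacements, h v (Multiset.mem_singleton_self v), Finset.map_singleton]; rfl
  | mul a b iha ihb =>
    have hletters : Monomial.letters (a.mul b : Monomial V) =
        Monomial.letters (a : Monomial V) + Monomial.letters (b : Monomial V) :=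
      Monomial.letters_mul (a : Monomial V) b
    rw [replacements, iha fun v hv => h v (hletters.symm ▸ Multiset.mem_add.mpr (.inl hv)),
      ihb fun v hv => h v (hletters.symm ▸ Multiset.mem_add.mpr (.inr hv)),
      Finset.singleton_product_singleton, Finset.map_singleton]
    rfl

namespace NAPowerSeries

variable {R : Type v} [CommRing R]

/-- The substitution of `∑ v'`, over the letters `v` with `s ∈ P v`, for each variable `s'`. It is
given by its effect on coefficients, since these sums may be infinite. -/
def subst (P : V → Finset S) (g : NAPowerSeries S R) : NAPowerSeries V R :=
  fun w => WithOne.recOneCoe (coeff 1 g)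
    (fun a => ∑ b ∈ replacements P a, coeff (b : Monomial S) g) w

variable (P : V → Finset S)

theorem coeff_one_subst (g : NAPowerSeries S R) : coeff 1 (subst P g) = coeff 1 g := rfl

theorem coeff_coe_subst (g : NAPowerSeries S R) (a : FreeMagma V) :
    coeff (a : Monomial V) (subst P g) = ∑ b ∈ replacements P a, coeff (b : Monomial S) g := rfl

theorem subst_one : subst P (1 : NAPowerSeries S R) = 1 := by
  ext w
  cases w using WithOne.recOneCoe with
  | one => rw [coeff_one_subst, coeff_one_one, coeff_one_one]
  | coe a =>
    rw [coeff_coe_subst, coeff_coe_one, Finset.sum_eq_zero fun b _ => coeff_coe_one b]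

theorem subst_add (g h : NAPowerSeries S R) : subst P (g + h) = subst P g + subst P h := by
  ext w
  cases w using WithOne.recOneCoe with
  | one => rfl
  | coe a => exact Finset.sum_add_distrib

theorem subst_mul (g h : NAPowerSeries S R) : subst P (g * h) = subst P g * subst P h := by
  refine ext_cases ?_ (fun v => ?_) fun a b => ?_
  · simp only [coeff_one_subst, coeff_one_mul]
  · simp only [coeff_coe_subst, sum_replacements_of, coeff_of_mul, coeff_one_subst,
      Finset.sum_add_distrib, Finset.mul_sum, Finset.sum_mul]
  · simp only [coeff_coe_subst, sum_replacements_mul, coeff_mul_mul, coeff_one_subst,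
      Finset.sum_add_distrib, ← Finset.mul_sum, ← Finset.sum_mul]

/-- The substitution `subst P` as a homomorphism of algebras. -/
noncomputable def substHom (R : Type v) [CommRing R] (P : V → Finset S) :
    NAPowerSeries S R →+* NAPowerSeries V R where
  __ := AddMonoidHom.mk' (subst P) (subst_add P)
  map_one' := subst_one P
  map_mul' := subst_mul P

theorem coeff_substHom_eq_zero {g : NAPowerSeries S R} {w : Monomial V}
    (h : ∀ w' : Monomial S, w'.degree = w.degree → coeff w' g = 0) :
    coeff w (substHom R P g) = 0 := by
  cases w using WithOne.recOneCoe with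
  | one => exact h 1 rfl
  | coe a => exact Finset.sum_eq_zero fun b hb => h b (length_of_mem_replacements hb)

open Classical in
theorem coeff_coe_substHom_X (s : S) (a : FreeMagma V) :
    coeff (a : Monomial V) (substHom R P (X R s)) =
      if ∃ v, a = .of v ∧ s ∈ P v then 1 else 0 := by
  rw [← of_mem_replacements_iff]
  convert Finset.sum_ite_eq' (replacements P a) (.of s) fun _ => (1 : R) using 1
  · exact Finset.sum_congr rfl fun b _ => if_congr WithOne.coe_inj rfl rfl
  · congr

theorem substHom_X {s : S} {t : V} (h : ∀ v, s ∈ P v ↔ v = t) :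
    substHom R P (X R s) = X R t := by
  classical
  ext w
  cases w using WithOne.recOneCoe with
  | one => exact (coeff_one_X s).trans (coeff_one_X t).symm
  | coe a =>
    rw [coeff_coe_substHom_X]
    refine if_congr ?_ rfl rfl
    simp only [h, exists_eq_right, WithOne.coe_inj]

theorem substHom_X_eq_zero {s : S} (h : ∀ v, s ∉ P v) : substHom R P (X R s) = 0 := by
  ext w
  cases w using WithOne.recOneCoe with
  | one => exact coeff_one_X s
  | coe a => rw [coeff_coe_substHom_X, if_neg fun ⟨v, _, hv⟩ => h v hv, coeff_zero]

theorem mem_involving_of_substHom_eq_zero [DecidableEq V] {v : V} {f : NAPowerSeries V R}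
    (hf : substHom R (fun t => ({t} : Finset V).erase v) f = 0) : f ∈ involving R v := by
  rw [mem_involving]
  intro w hw
  have hcoeff := congrArg (coeff w) hf
  cases w using WithOne.recOneCoe with
  | one => exact hcoeff
  | coe a =>
    have hfixed (t) (ht : t ∈ Monomial.letters (a : Monomial V)) : ({t} : Finset V).erase v = {t} :=
      Finset.erase_eq_of_notMem fun hv => hw ((Finset.mem_singleton.mp hv).symm ▸ ht)
    change coeff (a : Monomial V) (subst _ f) = 0 at hcoeff
    rwa [coeff_coe_subst, replacements_eq_singleton hfixed, Finset.sum_singleton] at hcoeff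

end NAPowerSeries

namespace UnitSeries

open NAPowerSeries

variable {R : Type v} [CommRing R]

/-- The substitution `NAPowerSeries.substHom` on the loop of series with constant term `1`. -/
noncomputable def substHom (R : Type v) [CommRing R] (P : V → Finset S) :
    UnitSeries S R →* UnitSeries V R where
  toFun g := ⟨NAPowerSeries.substHom R P g.1, g.2⟩
  map_one' := Subtype.ext (map_one (NAPowerSeries.substHom R P))
  map_mul' g h := Subtype.ext (map_mul (NAPowerSeries.substHom R P) g.1 h.1)

theorem val_substHom (P : V → Finset S) (g : UnitSeries S R) :
    (substHom R P g).1 = NAPowerSeries.substHom R P g.1 := rfl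

theorem substHom_oneAddX {P : V → Finset S} {s : S} {t : V} (h : ∀ v, s ∈ P v ↔ v = t) :
    substHom R P (oneAddX R s) = oneAddX R t := by
  refine Subtype.ext ?_
  rw [val_substHom, val_oneAddX, map_add, map_one, NAPowerSeries.substHom_X P h, val_oneAddX]

theorem substHom_oneAddX_eq_one {P : V → Finset S} {s : S} (h : ∀ v, s ∉ P v) :
    substHom R P (oneAddX R s) = 1 := by
  refine Subtype.ext ?_
  rw [val_substHom, val_oneAddX, map_add, map_one, substHom_X_eq_zero P h, add_zero, val_one]

end UnitSeries

end LetterSubstitution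

section LeadingTerms

open NAPowerSeries UnitSeries

variable {V : Type u} {R : Type v} [CommRing R] {m n : ℕ}

theorem deviationP_oneAddX_sub_one_mem_involving (hm : 1 ≤ m) (hn : 1 ≤ n) (x : Fin m → V)
    (y : Fin n → V) (z : V) {v : V} (hv : (∃ i, x i = v) ∨ (∃ j, y j = v) ∨ z = v) :
    (deviationP m n (fun i => oneAddX R (x i)) (fun j => oneAddX R (y j)) (oneAddX R z)).1 - 1 ∈
      involving R v := by
  classical
  have herase (t) (ht : t = v) :
      UnitSeries.substHom R (fun t => ({t} : Finset V).erase v) (oneAddX R t) = 1 :=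
    substHom_oneAddX_eq_one fun u => by simp [ht]
  refine mem_involving_of_substHom_eq_zero ?_
  rw [map_sub, map_one, ← val_substHom, map_deviationP, deviationP_eq_one hm hn, val_one, sub_self]
  exact hv.imp (fun ⟨i, hi⟩ => ⟨i, herase _ hi⟩)
    (Or.imp (fun ⟨j, hj⟩ => ⟨j, herase _ hj⟩) (herase z))

theorem primOp_X_mem_involving (x : Fin m → V) (y : Fin n → V) (z : V) {v : V}
    (hv : (∃ i, x i = v) ∨ (∃ j, y j = v) ∨ z = v) :
    primOp m n (fun i => X R (x i)) (fun j => X R (y j)) (X R z) ∈ involving R v := by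
  rw [← primOpOn_univ]
  rcases hv with ⟨i, rfl⟩ | ⟨j, rfl⟩ | rfl
  · exact primOpOn_X_mem_involving_left x y z (Finset.mem_univ i)
  · exact primOpOn_X_mem_involving_right x y z (Finset.mem_univ j)
  · exact primOpOn_X_mem_involving_last x y z _ _

/-- The letters `x_1, …, x_m, y_1, …, y_n, z`, taken to be distinct; `none` stands for `z`. -/
abbrev GenericLetter (m n : ℕ) : Type := Option (Fin m ⊕ Fin n)

namespace GenericLetter

/-- The series `𝓜(P_{m,n}) - (1 + p_{m,n})` for distinct letters. -/
noncomputable def remainder (m n : ℕ) (R : Type v) [CommRing R] :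
    NAPowerSeries (GenericLetter m n) R :=
  (deviationP m n (fun i => oneAddX R (some (.inl i))) (fun j => oneAddX R (some (.inr j)))
      (oneAddX R none)).1 -
    (1 + primOp m n (fun i => X R (some (.inl i))) (fun j => X R (some (.inr j))) (X R none))

theorem coeff_remainder_eq_zero (hm : 1 ≤ m) (hn : 1 ≤ n) {w : Monomial (GenericLetter m n)}
    (hw : w.degree < m + n + 2) : coeff w (remainder m n R) = 0 := by
  have hletter (v : GenericLetter m n) :
      (∃ i, some (.inl i) = v) ∨ (∃ j, some (.inr j) = v) ∨ none = v := by
    rcases v with _ | i | j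
    exacts [.inr (.inr rfl), .inl ⟨i, rfl⟩, .inr (.inl ⟨j, rfl⟩)]
  refine coeff_eq_zero_of_degree_le_card (fun v => ?_) ?_ ?_
  · rw [remainder, ← sub_sub]
    exact sub_mem (deviationP_oneAddX_sub_one_mem_involving hm hn _ _ _ (hletter v))
      (primOp_X_mem_involving _ _ _ (hletter v))
  · obtain ⟨m, rfl⟩ := Nat.exists_eq_add_of_le' hm
    obtain ⟨n, rfl⟩ := Nat.exists_eq_add_of_le' hn
    exact modRepeating_eq_iff.mp (modRepeating_deviationP m n _ _ _)
  · simp only [Fintype.card_option, Fintype.card_sum, Fintype.card_fin]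
    omega

end GenericLetter

theorem exists_magnus_deviationP_eq (hm : 1 ≤ m) (hn : 1 ≤ n) (x : Fin m → V) (y : Fin n → V)
    (z : V) :
    ∃ E : NAPowerSeries V R, (∀ w : Monomial V, w.degree < m + n + 2 → coeff w E = 0) ∧
      magnus R (deviationP m n (fun i => .of (x i)) (fun j => .of (y j)) (.of z)) =
        1 + primOp m n (fun i => X R (x i)) (fun j => X R (y j)) (X R z) + E := by
  classical
  let f (s : GenericLetter m n) : V := s.elim z (Sum.elim x y)
  let P (v : V) : Finset (GenericLetter m n) := {s | f s = v}
  have hP (s : GenericLetter m n) (v : V) : s ∈ P v ↔ v = f s :=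
    (Finset.mem_filter_univ s).trans eq_comm
  refine ⟨NAPowerSeries.substHom R P (GenericLetter.remainder m n R), fun w hw =>
    coeff_substHom_eq_zero P fun w' hw' =>
      GenericLetter.coeff_remainder_eq_zero hm hn (hw'.trans_lt hw), ?_⟩
  rw [GenericLetter.remainder, map_sub, map_add, map_one, map_primOp, ← val_substHom,
    map_deviationP, magnus, map_deviationP]
  simp only [NAPowerSeries.substHom_X P (hP _), substHom_oneAddX (hP _)]
  exact (add_sub_cancel _ _).symm

end LeadingTerms

end MagnusLoop

theorem proposition1 {V : Type*} {R : Type*} [CommRing R] (m n : ℕ) (hm : 1 ≤ m) (hn : 1 ≤ n)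
    (x : Fin m → V) (y : Fin n → V) (z : V) :
    (∃ E : NAPowerSeries V R,
      (∀ w : Monomial V, w.degree < m + n + 2 → NAPowerSeries.coeff w E = 0) ∧
      magnus R (deviationP m n (fun i => FreeLoop.of (x i)) (fun j => FreeLoop.of (y j))
          (FreeLoop.of z)) =
        1 + primOp m n (fun i => NAPowerSeries.X R (x i)) (fun j => NAPowerSeries.X R (y j))
          (NAPowerSeries.X R z) + E) ∧
    (∀ w : Monomial V, w.degree ≠ m + n + 1 →
      NAPowerSeries.coeff w (primOp m n (fun i => NAPowerSeries.X R (x i))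
        (fun j => NAPowerSeries.X R (y j)) (NAPowerSeries.X R z)) = 0) ∧
    (Nontrivial R →
      primOp m n (fun i => NAPowerSeries.X R (x i)) (fun j => NAPowerSeries.X R (y j))
        (NAPowerSeries.X R z) ≠ 0) :=
  ⟨exists_magnus_deviationP_eq hm hn x y z,
    fun _ hw => NAPowerSeries.coeff_primOp_X_of_degree_ne x y z hw,
    fun _ => NAPowerSeries.primOp_X_ne_zero (by omega) (by omega) x y z⟩
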